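/- Let $\mathbb{D}=\{z\in\mathbb{C}:|z|<1\}$. For $1\le p<\infty$ and $f$ holomorphic in $\mathbb{D}$ put $$\|f\|_{H^p}=\sup_{0\le\rho<1}\Big(\frac1{2\pi}\int_0^{2\pi}|f(\rho e^{i\theta})|^p\,d\theta\Big)^{1/p},$$ and, for $\beta>-1$, $$\|f\|_{A^p(\beta)}=\Big(\int_{\mathbb{D}}|f(z)|^p(1-|z|^2)^\beta\,d\mathcal{A}(z)\Big)^{1/p},$$ where $\mathcal{A}$ is the area measure normalized so that $\mathcal{A}(\mathbb{D})=1$. For $\sigma=(\lambda_1,\dots,\lambda_n)\in\mathbb{D}^n$ let $P_\sigma(z)=\prod_{i=1}^n(z-\lambda_i)$, and for $f$ holomorphic in $\mathbb{D}$ define $$\mathcal{M}(f,\sigma)=\sup\{\|f(T)\| : T\in\mathbb{C}^{n\times n},\ \|T\|\le1,\ m_T=P_\sigma\},$$ where $\|\cdot\|$ is the operator norm induced by the Euclidean (Hilbert) norm on $\mathbb{C}^n$, $m_T$ is the minimal polynomial of $T$, and $f(T)=\sum_{k\ge0}\frac{f^{(k)}(0)}{k!}T^k$ (the series converges since the spectrum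 of $T$ lies in $\mathbb{D}$). (1) For every $p\in[1,\infty)$ there are constants $a,b>0$ depending only on $p$ such that for all integers $n\ge1$ and all $r\in[0,1)$ $$a\Big(\frac{n}{1-r}\Big)^{1/p}\le\sup\big\{\mathcal{M}(f,\sigma): f \text{ holomorphic in }\mathbb{D},\ \|f\|_{H^p}\le1,\ \sigma\in\mathbb{D}^n,\ \max_{\lambda\in\sigma}|\lambda|\le r\big\}\le b\Big(\frac{n}{1-r}\Big)^{1/p}.$$ (2) For every $p\in[1,\infty)$ and $\beta>-1$ there are constants $a,b>0$ depending only on $p$ and $\beta$ such that for all integers $n\ge1$ and all $r\in[0,1)$ $$a\Big(\frac{n}{1-r}\Big)^{(2+\beta)/p}\le\sup\big\{\mathcal{M}(f,\sigma): f \text{ holomorphic in }\mathbb{D},\ \|f\|_{A^p(\beta)}\le1,\ \sigma\in\mathbb{D}^n,\ \max_{\lambda\in\sigma}|\lambda|\le r\big\}\le b\Big(\frac{n}{1-r}\Big)^{(2+\beta)/p}.$$ -/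

import Mathlib

open scoped ENNReal

noncomputable section

namespace PtakYoung

/-- `‖f‖_{H^p}`: the supremum over `0 ≤ ρ < 1` of the `L^p` means of `f` over the circles
`|z| = ρ`, with respect to normalized arc length; `∞` if `f ∉ H^p`. -/
def hardyNorm (p : ℝ) (f : ℂ → ℂ) : ℝ≥0∞ :=
  ⨆ ρ ∈ Set.Ico (0 : ℝ) 1,
    ((ENNReal.ofReal (2 * Real.pi))⁻¹ *
      ∫⁻ θ in Set.Ioc 0 (2 * Real.pi), ‖f (circleMap 0 ρ θ)‖ₑ ^ p) ^ (1 / p)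

/-- `‖f‖_{A^p(β)}`: the `L^p` norm of `f` over the unit disc with weight `(1 - |z|²)^β`, with
respect to normalized area measure; `∞` if `f ∉ A^p(β)`. -/
def bergmanNorm (p β : ℝ) (f : ℂ → ℂ) : ℝ≥0∞ :=
  ((ENNReal.ofReal Real.pi)⁻¹ *
    ∫⁻ z in Metric.ball (0 : ℂ) 1,
      ‖f z‖ₑ ^ p * ENNReal.ofReal ((1 - ‖z‖ ^ 2) ^ β)) ^ (1 / p)

/-- `f(T) = ∑ₖ f̂(k) Tᵏ`, with `f̂(k)` the Taylor coefficients of `f` at `0`. For `f` holomorphic in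
the unit disc and a matrix `T` with spectrum in the unit disc the series converges. -/
def funcCalc {n : ℕ} (f : ℂ → ℂ) (T : Matrix (Fin n) (Fin n) ℂ) : Matrix (Fin n) (Fin n) ℂ :=
  ∑' k : ℕ, (iteratedDeriv k f 0 / (k.factorial : ℂ)) • T ^ k

/-- `P_σ`, the monic polynomial whose zeros, with multiplicities, are the terms of `σ`. -/
def monicPoly {n : ℕ} (σ : Fin n → ℂ) : Polynomial ℂ :=
  ∏ i, (Polynomial.X - Polynomial.C (σ i))

open scoped Matrix.Norms.L2Operator in
/-- `𝓜(f, σ)`: the supremum of `‖f(T)‖` over `n × n` contractions `T` with minimal polynomial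
`P_σ`. Here `‖·‖` is the operator norm for the Hilbert norm on `ℂⁿ`. -/
def ptakYoung {n : ℕ} (f : ℂ → ℂ) (σ : Fin n → ℂ) : ℝ≥0∞ :=
  ⨆ (T : Matrix (Fin n) (Fin n) ℂ) (_ : ‖T‖ ≤ 1) (_ : minpoly ℂ T = monicPoly σ),
    ‖funcCalc f T‖ₑ

/-- The supremum of `𝓜(f, σ)` over the functions `f` holomorphic in the unit disc with `N f ≤ 1`
and the sequences `σ` of length `n` in the unit disc with `max |λ| ≤ r`. -/
def supPtakYoung (N : (ℂ → ℂ) → ℝ≥0∞) (n : ℕ) (r : ℝ) : ℝ≥0∞ :=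
  ⨆ (f : ℂ → ℂ) (_ : DifferentiableOn ℂ f (Metric.ball 0 1)) (_ : N f ≤ 1)
    (σ : Fin n → ℂ) (_ : ∀ i, σ i ∈ Metric.ball (0 : ℂ) 1) (_ : ∀ i, ‖σ i‖ ≤ r),
    ptakYoung f σ

end PtakYoung

end

open scoped ENNReal ComplexConjugate InnerProductSpace
open Polynomial

namespace PtakYoung

/-! ### Orbits of contractions and an equivalent Hilbert norm. -/

section Operator

variable {E : Type*} [NormedAddCommGroup E] [InnerProductSpace ℂ E]

/-! Write N = n/(1-r). Upper bound: an annihilating polynomial with n zeros in |z| ≤ r forces the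
orbits of a contraction T to be square summable with constant 2N (`sum_norm_pow_apply_sq_le`). The
zeros are removed one at a time: with x = (1 - c̄T)z, passing from x to (T - c)z removes the zero c,
and the identity of `norm_sub_conj_smul_sq` makes the cost telescope along the orbit. Averaging
T*ᵏTᵏ then yields a form G with I ≤ G ≤ 2I for which T contracts by a factor 1 - δ with δ of order
1/N (`exists_isPositive_strict_contraction`).

Consequently S = T/ρ is still a strict G-contraction for ρ close to 1 on the scale 1/N, and f(T) is
the integral of f(ρe^{iθ}) against an operator Poisson kernel which is positive, has mean G, and is
bounded by a multiple of N (`norm_tsum_smul_pow_le`). Mass O(1) and height O(N) give ‖f(T)‖^p ≤ C N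
times the p-mean of f on |z| = ρ (`enorm_funcCalc_rpow_le`). In the Hardy case one such circle
suffices. In the Bergman case the estimate is averaged over an annulus of width about 1/N, whose
weighted mass, about N^{-(β+1)}, supplies the extra power (`le_of_forall_circle_le`).

Lower bound: take T to be the Möbius transform of the nilpotent Jordan block J having r as its only
eigenvalue, and f = c(1-ρz)^{-(m+1)} with 1-ρ = 1/(4N). The resolvent (1-ρT)⁻¹ is
(1-ρr)⁻¹(1+rJ)(1-κJ)⁻¹ with 1-κ ≤ 1/(2n). Its powers have nonnegative entries, so testing them on
the all-ones vector bounds their norms below by binomial sums (`le_norm_pow`, `le_supPtakYoung`).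
Integral estimates for f (`hardyNorm_peak_le_one`, `bergmanNorm_peak_le_one`) fix the size of c. -/

lemma norm_sub_conj_smul_sq (c : ℂ) (z w : E) :
    ‖z - conj c • w‖ ^ 2 = ‖w - c • z‖ ^ 2 + (1 - ‖c‖ ^ 2) * (‖z‖ ^ 2 - ‖w‖ ^ 2) := by
  have h1 := norm_sub_sq (𝕜 := ℂ) z (conj c • w)
  have h2 := norm_sub_sq (𝕜 := ℂ) w (c • z)
  rw [inner_smul_right, norm_smul, RCLike.norm_conj] at h1
  rw [inner_smul_right, norm_smul] at h2
  have h3 : RCLike.re (conj c * ⟪z, w⟫_ℂ) = RCLike.re (c * ⟪w, z⟫_ℂ) := by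
    rw [← inner_conj_symm z w, ← map_mul, RCLike.conj_re]
  rw [h1, h2, h3]
  ring

lemma norm_pow_apply_le {T : E →L[ℂ] E} (hT : ‖T‖ ≤ 1) (k : ℕ) (x : E) :
    ‖(T ^ (k + 1)) x‖ ≤ ‖(T ^ k) x‖ := by
  rw [pow_succ', mul_apply_eq_comp]
  exact (T.le_opNorm _).trans (mul_le_of_le_one_left (norm_nonneg _) hT)

variable [CompleteSpace E]

lemma exists_eq_sub_conj_smul {T : E →L[ℂ] E} (hT : ‖T‖ ≤ 1) {c : ℂ} (hc : ‖c‖ < 1) (x : E) :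
    ∃ z, x = z - conj c • T z ∧ (1 - ‖c‖) * ‖z‖ ≤ ‖x‖ := by
  have hlt : ‖conj c • T‖ < 1 := by
    rw [norm_smul, RCLike.norm_conj]
    exact (mul_le_of_le_one_right (norm_nonneg _) hT).trans_lt hc
  obtain ⟨u, hu⟩ := isUnit_one_sub_of_norm_lt_one hlt
  have hx : x = ((↑u⁻¹ : E →L[ℂ] E) x) - conj c • T ((↑u⁻¹ : E →L[ℂ] E) x) := by
    have : ((u : E →L[ℂ] E) * (↑u⁻¹ : E →L[ℂ] E)) x = x := by simp
    rw [hu] at this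
    simpa using this.symm
  refine ⟨_, hx, ?_⟩
  set z := (↑u⁻¹ : E →L[ℂ] E) x
  have h1 : ‖conj c • T z‖ ≤ ‖c‖ * ‖z‖ := by
    rw [norm_smul, RCLike.norm_conj]
    gcongr
    exact (T.le_opNorm z).trans (mul_le_of_le_one_left (norm_nonneg _) hT)
  have h2 := norm_sub_norm_le z (conj c • T z)
  rw [← hx] at h2
  linarith

/-- A contraction annihilated at `x` by a product of linear factors with zeros in `|z| ≤ r` has
square summable orbit through `x`, with an explicit bound. -/
lemma sum_norm_pow_apply_sq_le {T : E →L[ℂ] E} (hT : ‖T‖ ≤ 1) {r : ℝ} (hr : r < 1) (K : ℕ)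
    (l : List ℂ) (hl : ∀ c ∈ l, ‖c‖ ≤ r) (x : E)
    (hx : aeval T (l.map fun c => X - C c).prod x = 0) :
    ∑ k ∈ Finset.range K, ‖(T ^ k) x‖ ^ 2 ≤ l.length * (2 / (1 - r)) * ‖x‖ ^ 2 := by
  induction l generalizing x with
  | nil =>
    have : x = 0 := by simpa using hx
    simp [this]
  | cons c l ih =>
    have hcr : ‖c‖ ≤ r := hl c (by simp)
    have hc : ‖c‖ < 1 := hcr.trans_lt hr
    obtain ⟨z, hz, hzx⟩ := exists_eq_sub_conj_smul hT hc x
    -- This is `norm_sub_conj_smul_sq` for Tᵏz and Tᵏ⁺¹z. The last bracket telescopes when summed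
    -- over k.
    have key : ∀ k, ‖(T ^ k) x‖ ^ 2 = ‖(T ^ k) (T z - c • z)‖ ^ 2 +
        (1 - ‖c‖ ^ 2) * (‖(T ^ k) z‖ ^ 2 - ‖(T ^ (k + 1)) z‖ ^ 2) := by
      intro k
      have h1 : (T ^ k) (T z) = (T ^ (k + 1)) z := by
        rw [pow_succ, mul_apply_eq_comp]
      rw [hz, map_sub, map_smul, map_sub, map_smul, h1]
      exact norm_sub_conj_smul_sq c _ _
    set P : ℂ[X] := ((c :: l).map fun c => X - C c).prod with hP
    -- P(T) commutes with 1 - c̄T, which is injective because |c| < 1. Hence annihilation passes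
    -- from x to z.
    have hPz : aeval T P z = 0 := by
      obtain ⟨z', hz'⟩ : ∃ y, y = aeval T P z := ⟨_, rfl⟩
      have h0 : z' - conj c • T z' = 0 := by
        have hcomm : aeval T P (T z) = T (aeval T P z) := by
          have : aeval T P * T = T * aeval T P := by
            have := (Commute.all P X).map (aeval T)
            simpa using this.eq
          exact congrArg (fun A : E →L[ℂ] E => A z) this
        rw [← hx, hz, map_sub, map_smul, hcomm, hz']
      have h1 : ‖z'‖ = ‖c‖ * ‖T z'‖ := by
        rw [sub_eq_zero.1 h0, norm_smul, RCLike.norm_conj, ← sub_eq_zero.1 h0]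
      have h2 : ‖T z'‖ ≤ ‖z'‖ := (T.le_opNorm _).trans (mul_le_of_le_one_left (norm_nonneg _) hT)
      have h3 : ‖z'‖ ≤ 0 := by
        by_contra! h
        nlinarith [norm_nonneg c, norm_nonneg (T z')]
      rw [← hz']
      exact norm_le_zero_iff.1 h3
    have hw : aeval T (l.map fun c => X - C c).prod (T z - c • z) = 0 := by
      rw [← hPz, hP, List.map_cons, List.prod_cons, mul_comm, map_mul,
        mul_apply_eq_comp]
      simp [Algebra.algebraMap_eq_smul_one]
    have hIH := ih (fun d hd => hl d (by simp [hd])) _ hw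
    have hsum : ∑ k ∈ Finset.range K, ‖(T ^ k) x‖ ^ 2 =
        ∑ k ∈ Finset.range K, ‖(T ^ k) (T z - c • z)‖ ^ 2 +
          (1 - ‖c‖ ^ 2) * (‖z‖ ^ 2 - ‖(T ^ K) z‖ ^ 2) := by
      rw [Finset.sum_congr rfl fun k _ => key k, Finset.sum_add_distrib, ← Finset.mul_sum,
        Finset.sum_range_sub' (fun k => ‖(T ^ k) z‖ ^ 2)]
      simp
    have hc2 : 0 ≤ 1 - ‖c‖ ^ 2 := by nlinarith [norm_nonneg c]
    have hwx : ‖T z - c • z‖ ^ 2 ≤ ‖x‖ ^ 2 := by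
      have h := key 0
      have h1 : ‖T z‖ ≤ ‖z‖ := (T.le_opNorm _).trans (mul_le_of_le_one_left (norm_nonneg _) hT)
      have h2 : ‖T z‖ ^ 2 ≤ ‖z‖ ^ 2 := by gcongr
      simp only [pow_zero, one_apply_eq_self, zero_add, pow_one] at h
      nlinarith [mul_nonneg hc2 (sub_nonneg.2 h2)]
    have hz2 : (1 - ‖c‖ ^ 2) * ‖z‖ ^ 2 ≤ 2 / (1 - r) * ‖x‖ ^ 2 := by
      have h1 : ((1 - ‖c‖) * ‖z‖) ^ 2 ≤ ‖x‖ ^ 2 := by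
        have : 0 ≤ (1 - ‖c‖) * ‖z‖ := mul_nonneg (by linarith) (norm_nonneg _)
        gcongr
      have hr' : 0 < 1 - r := by linarith
      rw [div_mul_eq_mul_div, le_div_iff₀ hr']
      calc (1 - ‖c‖ ^ 2) * ‖z‖ ^ 2 * (1 - r) ≤ (1 - ‖c‖ ^ 2) * ‖z‖ ^ 2 * (1 - ‖c‖) := by
            gcongr
        _ = (1 + ‖c‖) * ((1 - ‖c‖) * ‖z‖) ^ 2 := by ring
        _ ≤ 2 * ‖x‖ ^ 2 := by gcongr; linarith
    have hl0 : (0 : ℝ) ≤ l.length * (2 / (1 - r)) :=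
      mul_nonneg (Nat.cast_nonneg _) (div_nonneg zero_le_two (by linarith))
    calc _ = _ := hsum
      _ ≤ l.length * (2 / (1 - r)) * ‖x‖ ^ 2 + (1 - ‖c‖ ^ 2) * ‖z‖ ^ 2 := by
          refine add_le_add (hIH.trans (by gcongr)) ?_
          gcongr
          linarith [sq_nonneg ‖(T ^ K) z‖]
      _ ≤ l.length * (2 / (1 - r)) * ‖x‖ ^ 2 + 2 / (1 - r) * ‖x‖ ^ 2 := by gcongr
      _ = _ := by simp; ring

/-- If the orbits of a contraction are uniformly square summable, then it is a strict contraction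
for an equivalent Hilbert norm `x ↦ re ⟪G x, x⟫`. -/
lemma exists_isPositive_strict_contraction {T : E →L[ℂ] E} (hT : ‖T‖ ≤ 1) {M : ℝ} (hM : 0 < M)
    (hsum : ∀ (K : ℕ) (x : E), ∑ k ∈ Finset.range K, ‖(T ^ k) x‖ ^ 2 ≤ M * ‖x‖ ^ 2) :
    ∃ G : E →L[ℂ] E, G.IsPositive ∧ ‖G‖ ≤ 2 ∧ (∀ x, ‖x‖ ^ 2 ≤ (⟪G x, x⟫_ℂ).re) ∧
      ∀ x, (⟪G (T x), T x⟫_ℂ).re ≤ (1 - 1 / (4 * M)) * (⟪G x, x⟫_ℂ).re := by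
  -- Orbit norms decrease, so K‖Tᴷx‖² ≤ M‖x‖². Taking K ≥ 2M halves the squared norm after K steps.
  obtain ⟨K, hK⟩ := exists_nat_ge (2 * M)
  have hanti : ∀ x, Antitone fun k => ‖(T ^ k) x‖ :=
    fun x => antitone_nat_of_succ_le fun k => norm_pow_apply_le hT k x
  have hTK : ∀ x, ‖(T ^ K) x‖ ^ 2 ≤ 1 / 2 * ‖x‖ ^ 2 := by
    intro x
    have h1 : (K : ℝ) * ‖(T ^ K) x‖ ^ 2 ≤ ∑ k ∈ Finset.range K, ‖(T ^ k) x‖ ^ 2 := by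
      have h := Finset.card_nsmul_le_sum (Finset.range K) (fun k => ‖(T ^ k) x‖ ^ 2)
        (‖(T ^ K) x‖ ^ 2) fun k hk =>
          pow_le_pow_left₀ (norm_nonneg _) (hanti x (Finset.mem_range.1 hk).le) 2
      rwa [Finset.card_range, nsmul_eq_mul] at h
    have h2 := h1.trans (hsum K x)
    have h3 : 2 * M * ‖(T ^ K) x‖ ^ 2 ≤ M * ‖x‖ ^ 2 := by
      refine le_trans ?_ h2
      gcongr
    have h4 : M * (2 * ‖(T ^ K) x‖ ^ 2) ≤ M * ‖x‖ ^ 2 := by linarith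
    have := le_of_mul_le_mul_left h4 hM
    linarith
  set H : E →L[ℂ] E := ∑ k ∈ Finset.range K, (T ^ k).adjoint ∘L (T ^ k) with hH
  set G : E →L[ℂ] E := 1 + ((1 / M : ℝ) : ℂ) • H with hG
  have hGpos : G.IsPositive := by
    refine ContinuousLinearMap.isPositive_one.add
      (ContinuousLinearMap.IsPositive.smul_of_nonneg ?_ ?_)
    · exact ContinuousLinearMap.isPositive_sum _ fun k _ =>
        ContinuousLinearMap.isPositive_adjoint_comp_self _
    · exact_mod_cast (by positivity : (0 : ℝ) ≤ 1 / M)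
  have hQ : ∀ x, (⟪G x, x⟫_ℂ).re =
      ‖x‖ ^ 2 + 1 / M * ∑ k ∈ Finset.range K, ‖(T ^ k) x‖ ^ 2 := by
    intro x
    have h1 : ⟪H x, x⟫_ℂ = ((∑ k ∈ Finset.range K, ‖(T ^ k) x‖ ^ 2 : ℝ) : ℂ) := by
      simp only [hH, sum_apply, sum_inner, ContinuousLinearMap.comp_apply,
        ContinuousLinearMap.adjoint_inner_left, inner_self_eq_norm_sq_to_K]
      simp
    rw [hG, add_apply, inner_add_left, smul_apply,
      inner_smul_left, h1, one_apply_eq_self, inner_self_eq_norm_sq_to_K, Complex.conj_ofReal,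
      ← Complex.ofReal_mul, Complex.add_re, Complex.ofReal_re]
    simp [← Complex.ofReal_pow]
  have hQ1 : ∀ x, ‖x‖ ^ 2 ≤ (⟪G x, x⟫_ℂ).re := by
    intro x
    rw [hQ]
    have : 0 ≤ 1 / M * ∑ k ∈ Finset.range K, ‖(T ^ k) x‖ ^ 2 := by positivity
    linarith
  have hQ2 : ∀ x, (⟪G x, x⟫_ℂ).re ≤ 2 * ‖x‖ ^ 2 := by
    intro x
    rw [hQ]
    have : 1 / M * ∑ k ∈ Finset.range K, ‖(T ^ k) x‖ ^ 2 ≤ 1 / M * (M * ‖x‖ ^ 2) := by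
      gcongr
      exact hsum K x
    rw [← mul_assoc, one_div_mul_cancel hM.ne'] at this
    linarith
  refine ⟨G, hGpos, ?_, hQ1, ?_⟩
  · rw [G.norm_eq_iSup_rayleighQuotient hGpos.isSymmetric]
    refine ciSup_le fun x => ?_
    have h0 : 0 ≤ G.rayleighQuotient x :=
      div_nonneg (hGpos.re_inner_nonneg_left x) (sq_nonneg _)
    rw [abs_of_nonneg h0]
    exact div_le_of_le_mul₀ (sq_nonneg _) zero_le_two (hQ2 x)
  · intro x
    have h1 : ∑ k ∈ Finset.range K, ‖(T ^ k) (T x)‖ ^ 2 =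
        ∑ k ∈ Finset.range K, ‖(T ^ k) x‖ ^ 2 - ‖x‖ ^ 2 + ‖(T ^ K) x‖ ^ 2 := by
      have h := Finset.sum_range_succ (fun k => ‖(T ^ k) x‖ ^ 2) K
      rw [Finset.sum_range_succ'] at h
      simp only [pow_zero, one_apply_eq_self] at h
      have h2 : ∀ k, (T ^ k) (T x) = (T ^ (k + 1)) x := fun k => by
        rw [pow_succ, mul_apply_eq_comp]
      simp only [h2]
      linarith
    have h2 : ‖T x‖ ^ 2 ≤ ‖x‖ ^ 2 := by
      have := (T.le_opNorm x).trans (mul_le_of_le_one_left (norm_nonneg _) hT)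
      gcongr
    have h3 : (⟪G (T x), T x⟫_ℂ).re ≤ (⟪G x, x⟫_ℂ).re - 1 / M * (1 / 2 * ‖x‖ ^ 2) := by
      rw [hQ, hQ, h1]
      have : 1 / M * (∑ k ∈ Finset.range K, ‖(T ^ k) x‖ ^ 2 - ‖x‖ ^ 2 + ‖(T ^ K) x‖ ^ 2) ≤
          1 / M * (∑ k ∈ Finset.range K, ‖(T ^ k) x‖ ^ 2 - 1 / 2 * ‖x‖ ^ 2) := by
        gcongr
        linarith [hTK x]
      rw [mul_sub] at this
      linarith
    -- The gain ‖x‖²/(2M) is measured in the Euclidean norm. The bound G ≤ 2I turns it into a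
    -- fraction 1/(4M) of the G-form.
    have h4 : 1 / (4 * M) * (⟪G x, x⟫_ℂ).re ≤ 1 / (4 * M) * (2 * ‖x‖ ^ 2) := by
      gcongr
      exact hQ2 x
    have h5 : 1 / (4 * M) * (2 * ‖x‖ ^ 2) = 1 / M * (1 / 2 * ‖x‖ ^ 2) := by
      field_simp
      ring
    linarith

end Operator

/-! ### Absolutely convergent trigonometric series. -/

section Fourier

lemma integral_exp_int_mul (m : ℤ) :
    ∫ θ in (0 : ℝ)..2 * Real.pi, Complex.exp (m * (θ * Complex.I)) =
      if m = 0 then (2 * Real.pi : ℂ) else 0 := by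
  split_ifs with hm
  · simp [hm]
  · have hc : (m : ℂ) * Complex.I ≠ 0 := by simp [hm]
    have h : ∀ θ : ℝ, (m : ℂ) * (θ * Complex.I) = m * Complex.I * θ := fun θ => by ring
    simp only [h]
    rw [integral_exp_mul_complex hc]
    have h1 : (m : ℂ) * Complex.I * ((2 * Real.pi : ℝ) : ℂ) = m * (2 * Real.pi * Complex.I) := by
      push_cast
      ring
    rw [h1, Complex.exp_int_mul_two_pi_mul_I]
    simp

lemma norm_exp_int_mul (m : ℤ) (θ : ℝ) : ‖Complex.exp (m * (θ * Complex.I))‖ = 1 := by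
  have : (m : ℂ) * (θ * Complex.I) = ((m * θ : ℝ) : ℂ) * Complex.I := by push_cast; ring
  rw [this, Complex.norm_exp_ofReal_mul_I]

lemma summable_norm_mul_exp {a : ℕ → ℂ} (ha : Summable fun j => ‖a j‖) (u : ℕ → ℤ) (θ : ℝ) :
    Summable fun j => ‖a j * Complex.exp (u j * (θ * Complex.I))‖ := by
  simpa only [norm_mul, norm_exp_int_mul, mul_one] using ha

lemma continuous_tsum_mul_exp {a : ℕ → ℂ} (ha : Summable fun j => ‖a j‖) (u : ℕ → ℤ) :
    Continuous fun θ : ℝ => ∑' j, a j * Complex.exp (u j * (θ * Complex.I)) :=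
  continuous_tsum (fun j => by fun_prop) ha fun j θ => by
    rw [norm_mul, norm_exp_int_mul, mul_one]

/-- Orthogonality of characters for products of absolutely convergent trigonometric series. -/
lemma integral_tsum_mul_tsum {a b : ℕ → ℂ} (ha : Summable fun j => ‖a j‖)
    (hb : Summable fun j => ‖b j‖) (u v : ℕ → ℤ) :
    ∫ θ in (0 : ℝ)..2 * Real.pi, (∑' j, a j * Complex.exp (u j * (θ * Complex.I))) *
        ∑' k, b k * Complex.exp (v k * (θ * Complex.I)) =
      ∑' q : ℕ × ℕ, a q.1 * b q.2 * if u q.1 + v q.2 = 0 then (2 * Real.pi : ℂ) else 0 := by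
  have hab : Summable fun q : ℕ × ℕ => ‖a q.1 * b q.2‖ := by
    simpa using ha.mul_norm hb
  have hterm : ∀ (q : ℕ × ℕ) (θ : ℝ), a q.1 * Complex.exp (u q.1 * (θ * Complex.I)) *
      (b q.2 * Complex.exp (v q.2 * (θ * Complex.I))) =
      a q.1 * b q.2 * Complex.exp ((u q.1 + v q.2 : ℤ) * (θ * Complex.I)) := by
    intro q θ
    rw [Int.cast_add, add_mul, Complex.exp_add]
    ring
  have h := intervalIntegral.hasSum_integral_of_dominated_convergence (μ := MeasureTheory.volume)
    (a := (0 : ℝ)) (b := 2 * Real.pi)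
    (F := fun (q : ℕ × ℕ) (θ : ℝ) =>
      a q.1 * b q.2 * Complex.exp ((u q.1 + v q.2 : ℤ) * (θ * Complex.I)))
    (f := fun θ : ℝ => (∑' j, a j * Complex.exp (u j * (θ * Complex.I))) *
        ∑' k, b k * Complex.exp (v k * (θ * Complex.I)))
    (fun q _ => ‖a q.1 * b q.2‖)
    (fun q => Continuous.aestronglyMeasurable (by fun_prop))
    (fun q => .of_forall fun θ _ => by rw [norm_mul, norm_exp_int_mul, mul_one])
    (.of_forall fun θ _ => hab) intervalIntegrable_const
    (.of_forall fun θ _ => by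
      have h1 := summable_norm_mul_exp ha u θ
      have h2 := summable_norm_mul_exp hb v θ
      rw [tsum_mul_tsum_of_summable_norm h1 h2]
      simp only [hterm]
      refine Summable.hasSum ?_
      have := summable_mul_of_summable_norm h1 h2
      simpa only [hterm] using this)
  rw [← h.tsum_eq]
  refine tsum_congr fun q => ?_
  rw [intervalIntegral.integral_const_mul, integral_exp_int_mul]

/-- Opposite frequencies survive only on the diagonal. This half of the Poisson kernel reproduces
the power series. -/
lemma integral_tsum_mul_tsum_neg {a b : ℕ → ℂ} (ha : Summable fun j => ‖a j‖)
    (hb : Summable fun j => ‖b j‖) :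
    ∫ θ in (0 : ℝ)..2 * Real.pi, (∑' j : ℕ, a j * Complex.exp ((j : ℤ) * (θ * Complex.I))) *
        ∑' k : ℕ, b k * Complex.exp ((-(k : ℤ) : ℤ) * (θ * Complex.I)) =
      2 * Real.pi * ∑' k, a k * b k := by
  rw [integral_tsum_mul_tsum ha hb (fun j => (j : ℤ)) fun k => -(k : ℤ), Summable.tsum_prod]
  · rw [← tsum_mul_left]
    refine tsum_congr fun j => ?_
    rw [tsum_eq_single j]
    · simp
      ring
    · intro k hk
      have : ¬ ((j : ℤ) + -(k : ℤ) = 0) := by omega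
      simp [this]
  · refine Summable.of_norm_bounded ((ha.mul_norm hb).mul_right (2 * Real.pi)) fun q => ?_
    rw [norm_mul]
    gcongr
    split_ifs
    · simp [abs_of_pos Real.pi_pos]
    · simp [Real.pi_pos.le]

/-- Nonnegative frequencies add to zero only at (0, 0). The analytic half of the Poisson kernel,
whose constant term is 0, therefore contributes nothing. -/
lemma integral_tsum_mul_tsum_pos {a b : ℕ → ℂ} (ha : Summable fun j => ‖a j‖)
    (hb : Summable fun j => ‖b j‖) :
    ∫ θ in (0 : ℝ)..2 * Real.pi, (∑' j : ℕ, a j * Complex.exp ((j : ℤ) * (θ * Complex.I))) *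
        ∑' k : ℕ, b k * Complex.exp ((k : ℤ) * (θ * Complex.I)) =
      2 * Real.pi * (a 0 * b 0) := by
  rw [integral_tsum_mul_tsum ha hb (fun j => (j : ℤ)) fun k => (k : ℤ), tsum_eq_single (0, 0)]
  · simp
    ring
  · rintro ⟨j, k⟩ hjk
    have : ¬ ((j : ℤ) + (k : ℤ) = 0) := by
      intro h
      apply hjk
      ext <;> simp <;> omega
    simp [this]

end Fourier

/-! ### The operator Poisson kernel. -/

section Poisson

variable {E : Type*} [NormedAddCommGroup E] [InnerProductSpace ℂ E]

/-- Expand the form at v - cu, with c unimodular making the cross term real and nonnegative. This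
arithmetic-mean version of Cauchy–Schwarz reduces the kernel at (y, x) to its diagonal values, whose
integrals are known. -/
lemma norm_inner_le_of_isPositive {D : E →L[ℂ] E} (hD : D.IsPositive) (v u : E) :
    ‖⟪D v, u⟫_ℂ‖ ≤ ((⟪D u, u⟫_ℂ).re + (⟪D v, v⟫_ℂ).re) / 2 := by
  obtain ⟨c, hc, hcw⟩ : ∃ c : ℂ, ‖c‖ = 1 ∧ c * ⟪D v, u⟫_ℂ = ‖⟪D v, u⟫_ℂ‖ := by
    rcases eq_or_ne ⟪D v, u⟫_ℂ 0 with h | h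
    · exact ⟨1, by simp, by simp [h]⟩
    · have h' : (‖⟪D v, u⟫_ℂ‖ : ℂ) ≠ 0 := by simpa using h
      refine ⟨‖⟪D v, u⟫_ℂ‖ / ⟪D v, u⟫_ℂ, ?_, div_mul_cancel₀ _ h⟩
      rw [norm_div, Complex.norm_real, norm_norm, div_self (norm_ne_zero_iff.2 h)]
  have h0 : 0 ≤ (⟪D (v - c • u), v - c • u⟫_ℂ).re := hD.re_inner_nonneg_left _
  have hsym : ⟪D u, v⟫_ℂ = conj ⟪D v, u⟫_ℂ := by
    rw [inner_conj_symm, hD.inner_left_eq_inner_right]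
  have hcc : conj c * c = 1 := by
    rw [mul_comm, Complex.mul_conj, Complex.normSq_eq_norm_sq, hc]
    simp
  have hexp : ⟪D (v - c • u), v - c • u⟫_ℂ =
      ⟪D v, v⟫_ℂ - c * ⟪D v, u⟫_ℂ - conj (c * ⟪D v, u⟫_ℂ) + ⟪D u, u⟫_ℂ := by
    simp only [map_sub, map_smul, inner_sub_left, inner_sub_right, inner_smul_left,
      inner_smul_right, hsym, map_mul]
    linear_combination hcc * ⟪D u, u⟫_ℂ
  rw [hexp, hcw] at h0
  simp at h0
  linarith

/-- The Neumann series of `(1 - e^{-iθ} S)⁻¹`. -/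
noncomputable def neumannSeries (S : E →L[ℂ] E) (θ : ℝ) : E →L[ℂ] E :=
  ∑' k : ℕ, Complex.exp ((-(k : ℤ) : ℤ) * (θ * Complex.I)) • S ^ k

/-- The Poisson kernel of `S` for the form `⟪G ·, ·⟫`. -/
noncomputable def poissonForm (G S : E →L[ℂ] E) (y x : E) (θ : ℝ) : ℂ :=
  ⟪G y, neumannSeries S θ x⟫_ℂ + ⟪G (neumannSeries S θ y), x⟫_ℂ - ⟪G y, x⟫_ℂ

variable {S G : E →L[ℂ] E}

lemma summable_norm_inner_pow (hS : Summable fun k => ‖S ^ k‖) (w x : E) :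
    Summable fun k => ‖⟪w, (S ^ k) x⟫_ℂ‖ := by
  refine Summable.of_nonneg_of_le (fun _ => norm_nonneg _) (fun k => ?_)
    ((hS.mul_left ‖w‖).mul_right ‖x‖)
  calc ‖⟪w, (S ^ k) x⟫_ℂ‖ ≤ ‖w‖ * ‖(S ^ k) x‖ := norm_inner_le_norm _ _
    _ ≤ ‖w‖ * (‖S ^ k‖ * ‖x‖) := by gcongr; exact (S ^ k).le_opNorm x
    _ = _ := by ring

/-- The k = 0 term is dropped because subtracting ⟪G y, x⟫ in `poissonForm` cancels it. -/
lemma summable_ite_conj_inner (hS : Summable fun k => ‖S ^ k‖) (y x : E) :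
    Summable fun k : ℕ => ‖(if k = 0 then 0 else conj ⟪G x, (S ^ k) y⟫_ℂ : ℂ)‖ := by
  refine Summable.of_nonneg_of_le (fun _ => norm_nonneg _) (fun k => ?_)
    (summable_norm_inner_pow hS (G x) y)
  split_ifs
  · simp
  · rw [RCLike.norm_conj]

variable [CompleteSpace E]

lemma summable_exp_smul_pow (hS : Summable fun k => ‖S ^ k‖) (θ : ℝ) :
    Summable fun k : ℕ => Complex.exp ((-(k : ℤ) : ℤ) * (θ * Complex.I)) • S ^ k := by
  refine Summable.of_norm ?_
  simpa only [norm_smul, norm_exp_int_mul, one_mul] using hS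

lemma neumannSeries_apply (hS : Summable fun k => ‖S ^ k‖) (θ : ℝ) (x : E) :
    x = neumannSeries S θ x -
      Complex.exp (-(θ * Complex.I)) • S (neumannSeries S θ x) := by
  have h1 : ∀ k : ℕ, Complex.exp ((-(k : ℤ) : ℤ) * (θ * Complex.I)) • S ^ k =
      (Complex.exp (-(θ * Complex.I)) • S) ^ k := by
    intro k
    rw [_root_.smul_pow, ← Complex.exp_nat_mul]
    congr 2
    push_cast
    ring
  have h2 := summable_exp_smul_pow hS θ
  simp only [h1] at h2
  have h3 := h2.one_sub_mul_tsum_pow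
  have h4 : neumannSeries S θ = ∑' k : ℕ, (Complex.exp (-(θ * Complex.I)) • S) ^ k := by
    simp only [neumannSeries, h1]
  rw [← h4] at h3
  have h5 := congrArg (fun A : E →L[ℂ] E => A x) h3
  simpa using h5.symm

lemma norm_neumannSeries_le (hS : Summable fun k => ‖S ^ k‖) (θ : ℝ) :
    ‖neumannSeries S θ‖ ≤ ∑' k, ‖S ^ k‖ := by
  refine tsum_of_norm_bounded hS.hasSum fun k => ?_
  rw [norm_smul, norm_exp_int_mul, one_mul]

lemma inner_neumannSeries (hS : Summable fun k => ‖S ^ k‖) (θ : ℝ) (w x : E) :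
    ⟪w, neumannSeries S θ x⟫_ℂ =
      ∑' k : ℕ, ⟪w, (S ^ k) x⟫_ℂ * Complex.exp ((-(k : ℤ) : ℤ) * (θ * Complex.I)) := by
  have h1 := (summable_exp_smul_pow hS θ).hasSum
  have h2 := (h1.mapL (ContinuousLinearMap.apply ℂ E x)).mapL (innerSL ℂ w)
  rw [← neumannSeries] at h2
  simp only [ContinuousLinearMap.apply_apply, innerSL_apply_apply, smul_apply,
    inner_smul_right] at h2
  rw [← h2.tsum_eq]
  exact tsum_congr fun k => mul_comm _ _

/-- This is the operator form of Re((1+w)/(1-w)) = (1-|w|²)/|1-w|². It shows that the kernel is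
positive as soon as S*GS ≤ G. -/
lemma poissonForm_eq (hS : Summable fun k => ‖S ^ k‖) (y x : E) (θ : ℝ) :
    poissonForm G S y x θ =
      ⟪(G - S.adjoint ∘L G ∘L S) (neumannSeries S θ y), neumannSeries S θ x⟫_ℂ := by
  have hx := neumannSeries_apply hS θ x
  have hy := neumannSeries_apply hS θ y
  set u := neumannSeries S θ x with hu
  set v := neumannSeries S θ y with hv
  set e := Complex.exp (-(θ * Complex.I)) with he
  have hee : conj e * e = 1 := by
    rw [mul_comm, Complex.mul_conj, Complex.normSq_eq_norm_sq]
    have : ‖e‖ = 1 := by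
      have := norm_exp_int_mul (-1) θ
      simpa [he] using this
    simp [this]
  rw [poissonForm, ← hu, ← hv]
  nth_rewrite 1 [hy]
  nth_rewrite 1 [hx]
  nth_rewrite 1 [hy]
  nth_rewrite 1 [hx]
  simp only [map_sub, map_smul, inner_sub_left, inner_sub_right, inner_smul_left,
    inner_smul_right, sub_apply, ContinuousLinearMap.comp_apply,
    ContinuousLinearMap.adjoint_inner_left]
  linear_combination -hee * ⟪G (S v), S u⟫_ℂ

lemma poissonForm_eq_tsum_add_tsum (hG : G.IsPositive) (hS : Summable fun k => ‖S ^ k‖) (y x : E)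
    (θ : ℝ) : poissonForm G S y x θ =
      ∑' k : ℕ, ⟪G y, (S ^ k) x⟫_ℂ * Complex.exp ((-(k : ℤ) : ℤ) * (θ * Complex.I)) +
      ∑' k : ℕ, (if k = 0 then 0 else conj ⟪G x, (S ^ k) y⟫_ℂ) *
        Complex.exp ((k : ℤ) * (θ * Complex.I)) := by
  have h1 : ⟪G (neumannSeries S θ y), x⟫_ℂ = ∑' k : ℕ, conj ⟪G x, (S ^ k) y⟫_ℂ *
        Complex.exp ((k : ℤ) * (θ * Complex.I)) := by
    rw [hG.inner_left_eq_inner_right, ← inner_conj_symm, inner_neumannSeries hS,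
      Complex.conj_tsum]
    refine tsum_congr fun k => ?_
    rw [map_mul, ← Complex.exp_conj]
    simp
  have hs : Summable fun k : ℕ => conj ⟪G x, (S ^ k) y⟫_ℂ *
        Complex.exp ((k : ℤ) * (θ * Complex.I)) := by
    refine Summable.of_norm (summable_norm_mul_exp ?_ (fun k : ℕ => (k : ℤ)) θ)
    simpa only [RCLike.norm_conj] using summable_norm_inner_pow hS (G x) y
  have hs' : Summable fun k : ℕ => (if k = 0 then 0 else conj ⟪G x, (S ^ k) y⟫_ℂ) *
        Complex.exp ((k : ℤ) * (θ * Complex.I)) :=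
    Summable.of_norm (summable_norm_mul_exp (summable_ite_conj_inner hS y x)
      (fun k : ℕ => (k : ℤ)) θ)
  rw [poissonForm, inner_neumannSeries hS, h1, hs.tsum_eq_zero_add, hs'.tsum_eq_zero_add,
    add_sub_assoc]
  congr 1
  simp [hG.inner_left_eq_inner_right]

lemma continuous_poissonForm (hG : G.IsPositive) (hS : Summable fun k => ‖S ^ k‖) (y x : E) :
    Continuous (poissonForm G S y x) := by
  rw [funext (poissonForm_eq_tsum_add_tsum hG hS y x)]
  exact (continuous_tsum_mul_exp (summable_norm_inner_pow hS (G y) x) fun k => -(k : ℤ)).add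
    (continuous_tsum_mul_exp (summable_ite_conj_inner hS y x) fun k => (k : ℤ))

/-- Poisson representation of `∑ aₖ Sᵏ` by the boundary values of `∑ aₖ zᵏ`. -/
lemma integral_mul_poissonForm (hG : G.IsPositive) (hS : Summable fun k => ‖S ^ k‖) {a : ℕ → ℂ}
    (ha : Summable fun k => ‖a k‖) (y x : E) :
    ∫ θ in (0 : ℝ)..2 * Real.pi, (∑' j : ℕ, a j * Complex.exp ((j : ℤ) * (θ * Complex.I))) *
        poissonForm G S y x θ = 2 * Real.pi * ∑' k, a k * ⟪G y, (S ^ k) x⟫_ℂ := by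
  have c0 := continuous_tsum_mul_exp ha fun k => (k : ℤ)
  have h1 := summable_norm_inner_pow hS (G y) x
  have h2 := summable_ite_conj_inner (G := G) hS y x
  have c1 := continuous_tsum_mul_exp h1 fun k => -(k : ℤ)
  have c2 := continuous_tsum_mul_exp h2 fun k => (k : ℤ)
  simp only [poissonForm_eq_tsum_add_tsum hG hS, mul_add]
  rw [intervalIntegral.integral_add ((c0.fun_mul c1).intervalIntegrable _ _)
    ((c0.fun_mul c2).intervalIntegrable _ _), integral_tsum_mul_tsum_neg ha h1,
    integral_tsum_mul_tsum_pos ha h2]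
  simp

end Poisson

/-! ### Bounds from the mass and height of the kernel. -/

section PoissonBound

variable {E : Type*} [NormedAddCommGroup E] [InnerProductSpace ℂ E] {S G : E →L[ℂ] E} {t : ℝ}

lemma re_inner_le_of_norm_le (hG2 : ‖G‖ ≤ 2) (x y : E) : (⟪G x, y⟫_ℂ).re ≤ 2 * ‖x‖ * ‖y‖ := by
  refine (Complex.re_le_norm _).trans ((norm_inner_le_norm _ _).trans ?_)
  gcongr
  exact (G.le_opNorm x).trans (by gcongr)

lemma norm_pow_le_of_strict_contraction (hG2 : ‖G‖ ≤ 2) (hG1 : ∀ x, ‖x‖ ^ 2 ≤ (⟪G x, x⟫_ℂ).re)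
    (ht : 0 ≤ t) (hS : ∀ x, (⟪G (S x), S x⟫_ℂ).re ≤ t ^ 2 * (⟪G x, x⟫_ℂ).re) (k : ℕ) :
    ‖S ^ k‖ ≤ 2 * t ^ k := by
  have h1 : ∀ (k : ℕ) (x : E),
      (⟪G ((S ^ k) x), (S ^ k) x⟫_ℂ).re ≤ (t ^ k) ^ 2 * (⟪G x, x⟫_ℂ).re := by
    intro k x
    induction k with
    | zero => simp
    | succ k ih =>
      rw [pow_succ', mul_apply_eq_comp]
      calc _ ≤ t ^ 2 * _ := hS _
        _ ≤ t ^ 2 * ((t ^ k) ^ 2 * (⟪G x, x⟫_ℂ).re) := by gcongr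
        _ = _ := by ring
  refine ContinuousLinearMap.opNorm_le_bound _ (by positivity) fun x => ?_
  have h2 := re_inner_le_of_norm_le hG2 x x
  have h3 : ‖(S ^ k) x‖ ^ 2 ≤ (2 * t ^ k * ‖x‖) ^ 2 := by
    calc ‖(S ^ k) x‖ ^ 2 ≤ (t ^ k) ^ 2 * (⟪G x, x⟫_ℂ).re := (hG1 _).trans (h1 k x)
      _ ≤ (t ^ k) ^ 2 * (2 * ‖x‖ * ‖x‖) := by gcongr
      _ ≤ _ := by nlinarith [sq_nonneg (t ^ k * ‖x‖)]
  exact (sq_le_sq₀ (norm_nonneg _) (by positivity)).1 h3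

lemma summable_norm_pow_of_strict_contraction (hG2 : ‖G‖ ≤ 2)
    (hG1 : ∀ x, ‖x‖ ^ 2 ≤ (⟪G x, x⟫_ℂ).re)
    (ht : 0 ≤ t) (ht1 : t < 1) (hS : ∀ x, (⟪G (S x), S x⟫_ℂ).re ≤ t ^ 2 * (⟪G x, x⟫_ℂ).re) :
    Summable fun k => ‖S ^ k‖ :=
  Summable.of_nonneg_of_le (fun _ => norm_nonneg _)
    (norm_pow_le_of_strict_contraction hG2 hG1 ht hS)
    ((summable_geometric_of_lt_one ht ht1).mul_left 2)

/-- Either s ≤ a, or s = s^{1-p}s^p ≤ a^{1-p}s^p. This pointwise splitting stands in for Hölder's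
inequality and covers p = 1 as well. -/
lemma le_add_rpow_mul_rpow {s a p : ℝ} (hs : 0 ≤ s) (ha : 0 < a) (hp : 1 ≤ p) :
    s ≤ a + a ^ (1 - p) * s ^ p := by
  rcases le_total s a with h | h
  · have : 0 ≤ a ^ (1 - p) * s ^ p := by positivity
    linarith
  · have hs' : 0 < s := ha.trans_le h
    have h1 : s ^ (1 - p) * s ^ p = s := by
      rw [← Real.rpow_add hs']
      simp
    have h2 : s ^ (1 - p) ≤ a ^ (1 - p) := Real.rpow_le_rpow_of_nonpos ha h (by linarith)
    have h3 : s ^ (1 - p) * s ^ p ≤ a ^ (1 - p) * s ^ p := by gcongr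
    linarith

variable [CompleteSpace E]

/-- The Poisson representation of the constant function 1 gives the total mass of the kernel. -/
lemma integral_re_poissonForm (hG : G.IsPositive) (hS : Summable fun k => ‖S ^ k‖) (x : E) :
    ∫ θ in (0 : ℝ)..2 * Real.pi, (poissonForm G S x x θ).re =
      2 * Real.pi * (⟪G x, x⟫_ℂ).re := by
  have h := integral_mul_poissonForm hG hS (a := fun k => if k = 0 then 1 else 0)
    (summable_of_ne_finset_zero (s := {0}) fun k hk => by
      simp at hk
      simp [hk]) x x
  have h1 : ∀ θ : ℝ, ∑' j : ℕ, (if j = 0 then (1 : ℂ) else 0) *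
      Complex.exp ((j : ℤ) * (θ * Complex.I)) = 1 := by
    intro θ
    rw [tsum_eq_single 0 fun k hk => by simp [hk]]
    simp
  rw [tsum_eq_single 0 fun k hk => by simp [hk]] at h
  simp only [h1, one_mul, if_true, pow_zero, one_apply_eq_self] at h
  have h2 := Complex.reCLM.intervalIntegral_comp_comm
    ((continuous_poissonForm hG hS x x).intervalIntegrable (μ := MeasureTheory.volume)
      0 (2 * Real.pi))
  simp only [Complex.reCLM_apply] at h2
  rw [h2, h]
  simp

/-- If `S` is a strict contraction for the form `⟪G ·, ·⟫`, then `∑ aₖ Sᵏ` is controlled by the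
`Lᵖ` mean of `∑ aₖ zᵏ` over the unit circle. -/
theorem norm_tsum_smul_pow_le (hG : G.IsPositive) (hG2 : ‖G‖ ≤ 2)
    (hG1 : ∀ x, ‖x‖ ^ 2 ≤ (⟪G x, x⟫_ℂ).re)
    (ht : 0 ≤ t) (ht1 : t < 1) (hS : ∀ x, (⟪G (S x), S x⟫_ℂ).re ≤ t ^ 2 * (⟪G x, x⟫_ℂ).re)
    {a : ℕ → ℂ} (ha : Summable fun k => ‖a k‖) {p α : ℝ} (hp : 1 ≤ p) (hα : 0 < α)
    (hF : 8 / (1 - t) * ∫ θ in (0 : ℝ)..2 * Real.pi,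
      ‖∑' j : ℕ, a j * Complex.exp ((j : ℤ) * (θ * Complex.I))‖ ^ p ≤ 2 * Real.pi * α ^ p) :
    ‖∑' k, a k • S ^ k‖ ≤ 3 * α := by
  have hsum := summable_norm_pow_of_strict_contraction hG2 hG1 ht ht1 hS
  have hpow := norm_pow_le_of_strict_contraction hG2 hG1 ht hS
  have hpi : 0 < 2 * Real.pi := by positivity
  set F : ℝ → ℂ := fun θ => ∑' j : ℕ, a j * Complex.exp ((j : ℤ) * (θ * Complex.I)) with hFdef
  have hFc : Continuous F := continuous_tsum_mul_exp ha fun k => (k : ℤ)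
  have hD : (G - S.adjoint ∘L G ∘L S).IsPositive := by
    refine ContinuousLinearMap.isPositive_def.2
      ⟨hG.isSymmetric.sub (hG.adjoint_conj S).isSymmetric, fun x => ?_⟩
    rw [ContinuousLinearMap.reApplyInnerSelf_apply, sub_apply, inner_sub_left,
      ContinuousLinearMap.comp_apply, ContinuousLinearMap.comp_apply,
      ContinuousLinearMap.adjoint_inner_left, map_sub]
    have h1 := hS x
    have h2 : 0 ≤ (⟪G x, x⟫_ℂ).re := hG.re_inner_nonneg_left x
    have h3 : t ^ 2 ≤ 1 := pow_le_one₀ ht ht1.le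
    simp only [RCLike.re_eq_complex_re]
    nlinarith
  have hRnorm : ∀ (θ : ℝ) (x : E), ‖neumannSeries S θ x‖ ≤ 2 / (1 - t) * ‖x‖ := by
    intro θ x
    refine ((neumannSeries S θ).le_opNorm x).trans ?_
    gcongr
    refine (norm_neumannSeries_le hsum θ).trans ?_
    have := Summable.tsum_le_tsum hpow hsum ((summable_geometric_of_lt_one ht ht1).mul_left 2)
    rwa [tsum_mul_left, tsum_geometric_of_lt_one ht ht1, ← div_eq_mul_inv] at this
  set w : E → ℝ → ℝ := fun x θ => (poissonForm G S x x θ).re with hw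
  have hwc : ∀ x, Continuous (w x) := fun x =>
    Complex.continuous_re.comp (continuous_poissonForm hG hsum x x)
  have hw0 : ∀ x θ, 0 ≤ w x θ := fun x θ => by
    simp only [hw, poissonForm_eq hsum]
    exact hD.re_inner_nonneg_left _
  -- Here w = 2 Re⟪G x, R x⟫ - ⟪G x, x⟫ with ‖G‖ ≤ 2 and ‖R x‖ ≤ 2/(1-t), R being the Neumann
  -- series.
  have hw1 : ∀ x θ, ‖x‖ ≤ 1 → w x θ ≤ 8 / (1 - t) := fun x θ hx => by
    have h1 : (⟪G (neumannSeries S θ x), x⟫_ℂ).re = (⟪G x, neumannSeries S θ x⟫_ℂ).re := by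
      rw [hG.inner_left_eq_inner_right, ← inner_conj_symm, Complex.conj_re]
    have h2 : 0 ≤ (⟪G x, x⟫_ℂ).re := hG.re_inner_nonneg_left x
    have h3 := re_inner_le_of_norm_le hG2 x (neumannSeries S θ x)
    have ht' : 0 < 1 - t := by linarith
    have h4 : 2 * ‖x‖ * ‖neumannSeries S θ x‖ ≤ 2 * 1 * (2 / (1 - t) * 1) := by
      gcongr
      exact (hRnorm θ x).trans (by gcongr)
    have h5 : 8 / (1 - t) = 2 * (2 * 1 * (2 / (1 - t) * 1)) := by ring
    simp only [hw, poissonForm, Complex.add_re, Complex.sub_re, h1]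
    linarith
  have hQ : ∀ x, ‖x‖ ≤ 1 → (⟪G x, x⟫_ℂ).re ≤ 2 := fun x hx =>
    (re_inner_le_of_norm_le hG2 x x).trans (by nlinarith [norm_nonneg x])
  have hα' : 0 ≤ α ^ (1 - p) := by positivity
  have hFp : Continuous fun θ => ‖F θ‖ ^ p :=
    hFc.norm.rpow_const fun θ => Or.inr (by linarith)
  have main : ∀ x y : E, ‖x‖ ≤ 1 → ‖y‖ ≤ 1 → ‖⟪G y, (∑' k, a k • S ^ k) x⟫_ℂ‖ ≤ 3 * α := by
    intro x y hx hy
    have hval : ⟪G y, (∑' k, a k • S ^ k) x⟫_ℂ = ∑' k, a k * ⟪G y, (S ^ k) x⟫_ℂ := by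
      have hs : Summable fun k => a k • S ^ k := by
        refine Summable.of_norm_bounded (ha.mul_right (2 : ℝ)) fun k => ?_
        rw [norm_smul]
        gcongr
        refine (hpow k).trans ?_
        linarith [pow_le_one₀ (n := k) ht ht1.le]
      have h2 := (hs.hasSum.mapL (ContinuousLinearMap.apply ℂ E x)).mapL (innerSL ℂ (G y))
      simp only [ContinuousLinearMap.apply_apply, innerSL_apply_apply, smul_apply,
        inner_smul_right] at h2
      exact h2.tsum_eq.symm
    have hint := integral_mul_poissonForm hG hsum ha y x
    rw [← hval] at hint
    -- The part of F below level α is charged to the mass of the kernel, the part with ‖F‖^p to its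
    -- height 8/(1-t).
    have hpt : ∀ θ, ‖F θ * poissonForm G S y x θ‖ ≤
        α * ((w x θ + w y θ) / 2) + α ^ (1 - p) * (8 / (1 - t)) * ‖F θ‖ ^ p := by
      intro θ
      have h1 : ‖poissonForm G S y x θ‖ ≤ (w x θ + w y θ) / 2 := by
        simp only [hw, poissonForm_eq hsum]
        exact norm_inner_le_of_isPositive hD _ _
      have h2 : (w x θ + w y θ) / 2 ≤ 8 / (1 - t) := by
        linarith [hw1 x θ hx, hw1 y θ hy]
      have h3 : 0 ≤ (w x θ + w y θ) / 2 := by linarith [hw0 x θ, hw0 y θ]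
      rw [norm_mul]
      calc ‖F θ‖ * ‖poissonForm G S y x θ‖
          ≤ (α + α ^ (1 - p) * ‖F θ‖ ^ p) * ((w x θ + w y θ) / 2) := by
            gcongr
            exact le_add_rpow_mul_rpow (norm_nonneg _) hα hp
        _ = α * ((w x θ + w y θ) / 2) + α ^ (1 - p) * ‖F θ‖ ^ p * ((w x θ + w y θ) / 2) := by
            ring
        _ ≤ α * ((w x θ + w y θ) / 2) + α ^ (1 - p) * ‖F θ‖ ^ p * (8 / (1 - t)) := by
            gcongr
        _ = _ := by ring
    have hi1 : IntervalIntegrable (fun θ => α * ((w x θ + w y θ) / 2)) MeasureTheory.volume 0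
        (2 * Real.pi) := by
      have := hwc x
      have := hwc y
      exact Continuous.intervalIntegrable (by fun_prop) _ _
    have hi2 : IntervalIntegrable (fun θ => α ^ (1 - p) * (8 / (1 - t)) * ‖F θ‖ ^ p)
        MeasureTheory.volume 0 (2 * Real.pi) :=
      Continuous.intervalIntegrable (by fun_prop) _ _
    have hle := (intervalIntegral.norm_integral_le_integral_norm (μ := MeasureTheory.volume)
      (f := fun θ => F θ * poissonForm G S y x θ) hpi.le).trans
        (intervalIntegral.integral_mono_on hpi.le
          ((hFc.mul (continuous_poissonForm hG hsum y x)).norm.intervalIntegrable _ _)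
          (hi1.add hi2) fun θ _ => hpt θ)
    rw [hint, intervalIntegral.integral_add hi1 hi2, intervalIntegral.integral_const_mul,
      intervalIntegral.integral_const_mul, intervalIntegral.integral_div,
      intervalIntegral.integral_add ((hwc x).intervalIntegrable _ _)
        ((hwc y).intervalIntegrable _ _), integral_re_poissonForm hG hsum,
      integral_re_poissonForm hG hsum, norm_mul] at hle
    have h2pi : ‖(2 * Real.pi : ℂ)‖ = 2 * Real.pi := by
      simp [abs_of_pos Real.pi_pos]
    rw [h2pi] at hle
    have h1 : α ^ (1 - p) * (8 / (1 - t)) * ∫ θ in (0 : ℝ)..2 * Real.pi, ‖F θ‖ ^ p ≤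
        2 * Real.pi * α := by
      have h2 : α ^ (1 - p) * α ^ p = α := by
        rw [← Real.rpow_add hα]
        simp
      calc _ = α ^ (1 - p) * (8 / (1 - t) * ∫ θ in (0 : ℝ)..2 * Real.pi, ‖F θ‖ ^ p) := by ring
        _ ≤ α ^ (1 - p) * (2 * Real.pi * α ^ p) := by gcongr
        _ = 2 * Real.pi * (α ^ (1 - p) * α ^ p) := by ring
        _ = _ := by rw [h2]
    have h3 : α * ((2 * Real.pi * (⟪G x, x⟫_ℂ).re + 2 * Real.pi * (⟪G y, y⟫_ℂ).re) / 2) ≤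
        2 * Real.pi * (2 * α) := by
      have : ((⟪G x, x⟫_ℂ).re + (⟪G y, y⟫_ℂ).re) / 2 ≤ 2 := by linarith [hQ x hx, hQ y hy]
      calc _ = 2 * Real.pi * (((⟪G x, x⟫_ℂ).re + (⟪G y, y⟫_ℂ).re) / 2 * α) := by ring
        _ ≤ _ := by gcongr
    refine le_of_mul_le_mul_left ?_ hpi
    linarith
  refine ContinuousLinearMap.opNorm_le_bound _ (by positivity) fun x => ?_
  set u := (∑' k, a k • S ^ k) x with hu
  rcases eq_or_ne u 0 with h0 | h0
  · rw [h0, norm_zero]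
    positivity
  have hx0 : x ≠ 0 := by
    rintro rfl
    simp [hu] at h0
  have hxn : 0 < ‖x‖ := norm_pos_iff.2 hx0
  have hun : 0 < ‖u‖ := norm_pos_iff.2 h0
  -- Pairing with the direction of u itself and using G ≥ I recovers ‖u‖.
  have h := main (((‖x‖⁻¹ : ℝ) : ℂ) • x) (((‖u‖⁻¹ : ℝ) : ℂ) • u)
    (by simp [norm_smul, inv_mul_cancel₀ hxn.ne']) (by simp [norm_smul, inv_mul_cancel₀ hun.ne'])
  rw [map_smul, map_smul, ← hu, inner_smul_left, inner_smul_right, norm_mul, norm_mul,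
    RCLike.norm_conj, Complex.norm_real, Complex.norm_real, norm_inv, norm_inv, norm_norm,
    norm_norm] at h
  have h1 : ‖u‖ ^ 2 ≤ ‖⟪G u, u⟫_ℂ‖ := (hG1 u).trans (Complex.re_le_norm _)
  have h2 : ‖u‖⁻¹ * (‖x‖⁻¹ * ‖u‖ ^ 2) ≤ 3 * α := le_trans (by gcongr) h
  have h3 : ‖u‖⁻¹ * (‖x‖⁻¹ * ‖u‖ ^ 2) = ‖u‖ / ‖x‖ := by
    field_simp
  rw [h3, div_le_iff₀ hxn] at h2
  exact h2

end PoissonBound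

/-! ### From Taylor series to circle means. -/

section UpperBound

lemma hasSum_taylor_circleMap {f : ℂ → ℂ} (hf : DifferentiableOn ℂ f (Metric.ball 0 1)) {ρ : ℝ}
    (hρ0 : 0 ≤ ρ) (hρ : ρ < 1) (θ : ℝ) :
    HasSum (fun j : ℕ => iteratedDeriv j f 0 / (j.factorial : ℂ) * (ρ : ℂ) ^ j *
      Complex.exp ((j : ℤ) * (θ * Complex.I))) (f (circleMap 0 ρ θ)) := by
  have hz : circleMap 0 ρ θ ∈ Metric.ball (0 : ℂ) 1 := by
    simpa [abs_of_nonneg hρ0] using hρ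
  have h := Complex.hasSum_taylorSeries_on_ball hf hz
  refine h.congr_fun fun j => ?_
  rw [sub_zero, circleMap_zero, mul_pow, ← Complex.exp_nat_mul]
  simp only [smul_eq_mul, Int.cast_natCast]
  ring

variable {E : Type*} [NormedAddCommGroup E] [InnerProductSpace ℂ E] [CompleteSpace E]

/-- Since f(T) = ∑ aₖρᵏ (T/ρ)ᵏ, the Poisson bound applies to S = T/ρ and to the values of f on |z| =
ρ. -/
theorem norm_tsum_taylor_smul_pow_le {T : E →L[ℂ] E} (hT : ‖T‖ ≤ 1) {M : ℝ} (hM : 1 ≤ M)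
    (hsum : ∀ (K : ℕ) (x : E), ∑ k ∈ Finset.range K, ‖(T ^ k) x‖ ^ 2 ≤ M * ‖x‖ ^ 2)
    {f : ℂ → ℂ} (hf : DifferentiableOn ℂ f (Metric.ball 0 1)) {ρ : ℝ}
    (hρ1 : 1 - 1 / (16 * M) ≤ ρ) (hρ : ρ < 1) {p α : ℝ} (hp : 1 ≤ p) (hα : 0 < α)
    (hF : 128 * M * ∫ θ in (0 : ℝ)..2 * Real.pi, ‖f (circleMap 0 ρ θ)‖ ^ p ≤
      2 * Real.pi * α ^ p) :
    ‖∑' k : ℕ, (iteratedDeriv k f 0 / (k.factorial : ℂ)) • T ^ k‖ ≤ 3 * α := by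
  obtain ⟨G, hG, hG2, hG1, hGT⟩ :=
    exists_isPositive_strict_contraction hT (by linarith : 0 < M) hsum
  have hM0 : 0 < M := by linarith
  -- T contracts the G-norm by q = √(1-4δ) ≤ 1-2δ, while ρ ≥ 1-δ. So T/ρ keeps a gap 1 - q/ρ ≥ δ,
  -- and 8/δ = 128M.
  set δ := 1 / (16 * M) with hδ
  have hδ0 : 0 < δ := by positivity
  have hδ1 : δ ≤ 1 / 16 := by
    rw [hδ]
    gcongr
    linarith
  have hδ4 : 1 / (4 * M) = 4 * δ := by
    rw [hδ]
    field_simp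
    norm_num
  rw [hδ4] at hGT
  set q := Real.sqrt (1 - 4 * δ) with hq
  have hq2 : q ^ 2 = 1 - 4 * δ := Real.sq_sqrt (by linarith)
  have hq0 : 0 ≤ q := Real.sqrt_nonneg _
  have hq1 : q ≤ 1 - 2 * δ := by
    apply Real.sqrt_le_iff.2
    exact ⟨by linarith, by nlinarith [sq_nonneg δ]⟩
  have hρ0 : 0 < ρ := by linarith
  have ht1 : q / ρ < 1 := by
    rw [div_lt_one hρ0]
    linarith
  have h1t : δ ≤ 1 - q / ρ := by
    rw [le_sub_iff_add_le, ← le_sub_iff_add_le', div_le_iff₀ hρ0]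
    nlinarith
  set S : E →L[ℂ] E := ((ρ⁻¹ : ℝ) : ℂ) • T with hS
  have hGS : ∀ x, (⟪G (S x), S x⟫_ℂ).re ≤ (q / ρ) ^ 2 * (⟪G x, x⟫_ℂ).re := by
    intro x
    have h1 : ⟪G (S x), S x⟫_ℂ = ((ρ⁻¹ ^ 2 : ℝ) : ℂ) * ⟪G (T x), T x⟫_ℂ := by
      rw [hS, smul_apply, map_smul, inner_smul_left, inner_smul_right, Complex.conj_ofReal]
      push_cast
      ring
    rw [h1, Complex.re_ofReal_mul, div_pow, hq2, div_eq_inv_mul, ← inv_pow, mul_assoc]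
    gcongr
    exact hGT x
  set b : ℕ → ℂ := fun k => iteratedDeriv k f 0 / (k.factorial : ℂ) with hb
  have ha : Summable fun k => ‖b k * (ρ : ℂ) ^ k‖ := by
    have := (hasSum_taylor_circleMap hf hρ0.le hρ 0).summable.norm
    simpa only [norm_mul, norm_exp_int_mul, mul_one] using this
  have key := norm_tsum_smul_pow_le hG hG2 hG1 (div_nonneg hq0 hρ0.le) ht1 hGS ha hp hα ?_
  · have : ∀ k, (b k * (ρ : ℂ) ^ k) • S ^ k = b k • T ^ k := by
      intro k
      rw [hS, _root_.smul_pow, smul_smul, mul_assoc, ← mul_pow, ← Complex.ofReal_mul,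
        mul_inv_cancel₀ hρ0.ne']
      simp
    simpa only [this] using key
  · have hFe : ∀ θ : ℝ, ∑' j : ℕ, b j * (ρ : ℂ) ^ j * Complex.exp ((j : ℤ) * (θ * Complex.I)) =
        f (circleMap 0 ρ θ) := fun θ => (hasSum_taylor_circleMap hf hρ0.le hρ θ).tsum_eq
    simp only [hFe]
    refine le_trans ?_ hF
    have hI : 0 ≤ ∫ θ in (0 : ℝ)..2 * Real.pi, ‖f (circleMap 0 ρ θ)‖ ^ p :=
      intervalIntegral.integral_nonneg (by positivity) fun θ _ => by positivity
    gcongr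
    calc 8 / (1 - q / ρ) ≤ 8 / δ := by gcongr
      _ = 128 * M := by
        rw [hδ]
        field_simp
        norm_num

end UpperBound

/-! ### The estimate for matrices with prescribed minimal polynomial. -/

section Matrix

open scoped Matrix.Norms.L2Operator

variable {n : ℕ}

lemma toEuclideanCLM_funcCalc (f : ℂ → ℂ) (T : Matrix (Fin n) (Fin n) ℂ) :
    Matrix.toEuclideanCLM (n := Fin n) (𝕜 := ℂ) (funcCalc f T) =
      ∑' k : ℕ, (iteratedDeriv k f 0 / (k.factorial : ℂ)) •
        Matrix.toEuclideanCLM (n := Fin n) (𝕜 := ℂ) T ^ k := by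
  set e := (Matrix.toEuclideanCLM (n := Fin n) (𝕜 := ℂ)).toAlgEquiv.toLinearEquiv
  have h := e.toContinuousLinearEquiv.map_tsum (L := .unconditional ℕ)
    (f := fun k : ℕ => (iteratedDeriv k f 0 / (k.factorial : ℂ)) • T ^ k)
  have h2 : ∀ A, e.toContinuousLinearEquiv A = Matrix.toEuclideanCLM (n := Fin n) (𝕜 := ℂ) A :=
    fun A => rfl
  simp only [h2, map_smul, map_pow] at h
  exact h

lemma sum_norm_pow_toEuclideanCLM_apply_le {σ : Fin n → ℂ} {r : ℝ} (hr : r < 1)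
    (hσ : ∀ i, ‖σ i‖ ≤ r) {T : Matrix (Fin n) (Fin n) ℂ} (hT : ‖T‖ ≤ 1)
    (hm : minpoly ℂ T = monicPoly σ) (K : ℕ) (x : EuclideanSpace ℂ (Fin n)) :
    ∑ k ∈ Finset.range K, ‖(Matrix.toEuclideanCLM (n := Fin n) (𝕜 := ℂ) T ^ k) x‖ ^ 2 ≤
      2 * ((n : ℝ) / (1 - r)) * ‖x‖ ^ 2 := by
  have h0 : aeval (Matrix.toEuclideanCLM (n := Fin n) (𝕜 := ℂ) T)
      (((List.ofFn σ).map fun c => X - C c).prod) = 0 := by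
    have h1 : ((List.ofFn σ).map fun c => X - C c).prod = minpoly ℂ T := by
      rw [hm, monicPoly, List.map_ofFn, List.prod_ofFn]
      rfl
    have h2 := aeval_algHom_apply
      (Matrix.toEuclideanCLM (n := Fin n) (𝕜 := ℂ)).toAlgEquiv.toAlgHom T (minpoly ℂ T)
    rw [minpoly.aeval, map_zero] at h2
    rw [h1]
    exact h2
  have h := sum_norm_pow_apply_sq_le (T := Matrix.toEuclideanCLM (n := Fin n) (𝕜 := ℂ) T)
    (by rwa [Matrix.l2_opNorm_toEuclideanCLM]) hr K (List.ofFn σ)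
    (by simpa [List.mem_ofFn] using hσ) x (by rw [h0]; rfl)
  rw [List.length_ofFn] at h
  refine h.trans_eq ?_
  ring

/-- Control of `f(T)` by the `Lᵖ` mean of `f` over a circle of radius close to `1`. -/
theorem enorm_funcCalc_rpow_le {σ : Fin n → ℂ} (hn : 1 ≤ n) {r : ℝ} (hr0 : 0 ≤ r) (hr : r < 1)
    (hσ : ∀ i, ‖σ i‖ ≤ r) {T : Matrix (Fin n) (Fin n) ℂ} (hT : ‖T‖ ≤ 1)
    (hm : minpoly ℂ T = monicPoly σ) {f : ℂ → ℂ} (hf : DifferentiableOn ℂ f (Metric.ball 0 1))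
    {ρ : ℝ} (hρ1 : 1 - 1 / (32 * (n / (1 - r))) ≤ ρ) (hρ : ρ < 1) {p : ℝ} (hp : 1 ≤ p) :
    ‖funcCalc f T‖ₑ ^ p ≤ ENNReal.ofReal (3 ^ p * 256 * (n / (1 - r))) *
      ((ENNReal.ofReal (2 * Real.pi))⁻¹ *
        ∫⁻ θ in Set.Ioc 0 (2 * Real.pi), ‖f (circleMap 0 ρ θ)‖ₑ ^ p) := by
  set N : ℝ := n / (1 - r) with hN
  have hN1 : 1 ≤ N := by
    rw [hN, le_div_iff₀ (by linarith)]
    have : (1 : ℝ) ≤ n := by exact_mod_cast hn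
    linarith
  have hp0 : 0 < p := by linarith
  have hpi : 0 < 2 * Real.pi := by positivity
  have hρ0 : 0 ≤ ρ := by
    have : 1 / (32 * N) ≤ 1 := by
      rw [div_le_one (by positivity)]
      linarith
    linarith
  have hcont : Continuous fun θ : ℝ => f (circleMap 0 ρ θ) := by
    refine hf.continuousOn.comp_continuous (continuous_circleMap 0 ρ) fun θ => ?_
    simpa [abs_of_nonneg hρ0] using hρ
  have hcp : Continuous fun θ : ℝ => ‖f (circleMap 0 ρ θ)‖ ^ p :=
    hcont.norm.rpow_const fun θ => Or.inr hp0.le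
  set I : ℝ := ∫ θ in (0 : ℝ)..2 * Real.pi, ‖f (circleMap 0 ρ θ)‖ ^ p with hI
  have hI0 : 0 ≤ I := intervalIntegral.integral_nonneg hpi.le fun θ _ => by positivity
  have hlint : ∫⁻ θ in Set.Ioc 0 (2 * Real.pi), ‖f (circleMap 0 ρ θ)‖ₑ ^ p =
      ENNReal.ofReal I := by
    rw [hI, intervalIntegral.integral_of_le hpi.le,
      MeasureTheory.ofReal_integral_eq_lintegral_ofReal]
    · refine MeasureTheory.lintegral_congr fun θ => ?_
      rw [← ofReal_norm, ENNReal.ofReal_rpow_of_nonneg (norm_nonneg _) hp0.le]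
    · exact (hcp.intervalIntegrable 0 (2 * Real.pi)).1
    · exact .of_forall fun θ => by positivity
  set B : ℝ := 256 * N * I / (2 * Real.pi) with hB
  have hB0 : 0 ≤ B := by positivity
  have hbound : ∀ α : ℝ, 0 < α → B ≤ α ^ p → ‖funcCalc f T‖ ≤ 3 * α := by
    intro α hα hBα
    rw [← Matrix.l2_opNorm_toEuclideanCLM, toEuclideanCLM_funcCalc]
    refine norm_tsum_taylor_smul_pow_le (M := 2 * N)
      (by rwa [Matrix.l2_opNorm_toEuclideanCLM]) (by linarith)
      (sum_norm_pow_toEuclideanCLM_apply_le hr hσ hT hm) hf ?_ hρ hp hα ?_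
    · rwa [← mul_assoc, (by norm_num : (16 : ℝ) * 2 = 32)]
    · rw [hB, div_le_iff₀ hpi] at hBα
      rw [← hI]
      linarith
  have hle : ‖funcCalc f T‖ ≤ 3 * B ^ (1 / p) := by
    -- `hbound` needs α > 0, but B may vanish; hence the ε of room.
    refine le_of_forall_pos_le_add fun ε hε => ?_
    have hB1 : 0 ≤ B ^ (1 / p) := by positivity
    refine (hbound (B ^ (1 / p) + ε / 3) (by positivity) ?_).trans_eq (by ring)
    calc B = (B ^ (1 / p)) ^ p := by
          rw [← Real.rpow_mul hB0, one_div_mul_cancel hp0.ne', Real.rpow_one]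
      _ ≤ _ := by
        gcongr
        linarith
  have hlep : ‖funcCalc f T‖ ^ p ≤ 3 ^ p * B := by
    calc ‖funcCalc f T‖ ^ p ≤ (3 * B ^ (1 / p)) ^ p := by gcongr
      _ = _ := by
        rw [Real.mul_rpow (by norm_num) (by positivity), ← Real.rpow_mul hB0,
          one_div_mul_cancel hp0.ne', Real.rpow_one]
  rw [hlint, ← ofReal_norm, ENNReal.ofReal_rpow_of_nonneg (norm_nonneg _) hp0.le,
    ← ENNReal.ofReal_inv_of_pos hpi, ← ENNReal.ofReal_mul (by positivity),
    ← ENNReal.ofReal_mul (by positivity)]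
  refine ENNReal.ofReal_le_ofReal (hlep.trans_eq ?_)
  rw [hB]
  ring

end Matrix

/-! ### Polar coordinates and the radial weight. -/

section Polar

open MeasureTheory

lemma lintegral_Ioo_circleMap (g : ℂ → ℝ≥0∞) (s : ℝ) :
    ∫⁻ θ in Set.Ioo (-Real.pi) Real.pi, g (circleMap 0 s θ) =
      ∫⁻ θ in Set.Ioc 0 (2 * Real.pi), g (circleMap 0 s θ) := by
  have hper : Function.Periodic (fun θ => g (circleMap 0 s θ)) (2 * Real.pi) := fun θ => by
    simp only [periodic_circleMap 0 s θ]
  have h1 := isAddFundamentalDomain_Ioc Real.two_pi_pos (-Real.pi)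
  have h2 := isAddFundamentalDomain_Ioc Real.two_pi_pos 0
  have h := h1.setLIntegral_eq h2 (fun θ => g (circleMap 0 s θ)) hper.map_vadd_zmultiples
  rw [zero_add, (by ring : -Real.pi + 2 * Real.pi = Real.pi)] at h
  rw [← h]
  exact setLIntegral_congr Ioo_ae_eq_Ioc

/-- Integration over the unit disc in polar coordinates. -/
lemma lintegral_ball_eq_lintegral_circleMap {g : ℂ → ℝ≥0∞} (hg : Measurable g) :
    ∫⁻ z in Metric.ball 0 1, g z = ∫⁻ s in Set.Ioo (0 : ℝ) 1,
      ENNReal.ofReal s * ∫⁻ θ in Set.Ioc 0 (2 * Real.pi), g (circleMap 0 s θ) := by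
  set g' : ℂ → ℝ≥0∞ := (Metric.ball (0 : ℂ) 1).indicator g with hg'
  have hg'm : Measurable g' := hg.indicator Metric.isOpen_ball.measurableSet
  have hsymm : ∀ q : ℝ × ℝ, Complex.polarCoord.symm q = circleMap 0 q.1 q.2 := by
    intro q
    rw [Complex.polarCoord_symm_apply, circleMap_zero, Complex.exp_mul_I]
    simp
  have hcm : Measurable fun q : ℝ × ℝ => circleMap 0 q.1 q.2 := by
    simp only [circleMap]
    fun_prop
  rw [← lintegral_indicator Metric.isOpen_ball.measurableSet, ← hg',
    ← Complex.lintegral_comp_polarCoord_symm]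
  simp only [hsymm, smul_eq_mul]
  rw [polarCoord_target, Measure.volume_eq_prod, setLIntegral_prod]
  · rw [← lintegral_indicator measurableSet_Ioo, ← lintegral_indicator measurableSet_Ioi]
    refine lintegral_congr fun s => ?_
    by_cases hs : s ∈ Set.Ioo (0 : ℝ) 1
    · rw [Set.indicator_of_mem hs, Set.indicator_of_mem (Set.mem_Ioi.2 hs.1),
        lintegral_const_mul' _ _ ENNReal.ofReal_ne_top, lintegral_Ioo_circleMap]
      congr 1
      refine lintegral_congr fun θ => ?_
      rw [hg', Set.indicator_of_mem]
      simpa [abs_of_pos hs.1] using hs.2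
    · rw [Set.indicator_of_notMem hs]
      by_cases hs0 : 0 < s
      · have hs1 : 1 ≤ s := by
          by_contra! h
          exact hs ⟨hs0, h⟩
        have : ∀ θ, g' (circleMap 0 s θ) = 0 := fun θ => by
          rw [hg', Set.indicator_of_notMem]
          simpa [abs_of_pos hs0] using hs1
        simp [this]
      · rw [Set.indicator_of_notMem (by simpa using hs0)]
  · refine Measurable.aemeasurable ?_
    exact (ENNReal.measurable_ofReal.comp measurable_fst).mul (hg'm.comp hcm)

lemma lintegral_bergman_eq {f : ℂ → ℂ} (hf : ContinuousOn f (Metric.ball 0 1)) (p β : ℝ) :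
    ∫⁻ z in Metric.ball (0 : ℂ) 1, ‖f z‖ₑ ^ p * ENNReal.ofReal ((1 - ‖z‖ ^ 2) ^ β) =
      ∫⁻ s in Set.Ioo (0 : ℝ) 1, ENNReal.ofReal (s * (1 - s ^ 2) ^ β) *
        ∫⁻ θ in Set.Ioc 0 (2 * Real.pi), ‖f (circleMap 0 s θ)‖ₑ ^ p := by
  classical
  -- Outside the disc f is arbitrary, so it is replaced by 0 there to gain measurability.
  set f' : ℂ → ℂ := (Metric.ball (0 : ℂ) 1).indicator f with hf'
  have hf'm : Measurable f' := by
    have := hf.measurable_piecewise (continuousOn_const (c := (0 : ℂ)))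
      Metric.isOpen_ball.measurableSet
    rwa [hf', ← Set.piecewise_eq_indicator]
  have h1 : ∫⁻ z in Metric.ball (0 : ℂ) 1, ‖f z‖ₑ ^ p * ENNReal.ofReal ((1 - ‖z‖ ^ 2) ^ β) =
      ∫⁻ z in Metric.ball (0 : ℂ) 1, ‖f' z‖ₑ ^ p * ENNReal.ofReal ((1 - ‖z‖ ^ 2) ^ β) := by
    refine setLIntegral_congr_fun Metric.isOpen_ball.measurableSet fun z hz => ?_
    simp only [hf', Set.indicator_of_mem hz]
  rw [h1, lintegral_ball_eq_lintegral_circleMap (by fun_prop)]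
  refine setLIntegral_congr_fun measurableSet_Ioo fun s hs => ?_
  have h2 : ∀ θ, f' (circleMap 0 s θ) = f (circleMap 0 s θ) := fun θ => by
    rw [hf', Set.indicator_of_mem]
    simpa [abs_of_pos hs.1] using hs.2
  simp only [h2, norm_circleMap_zero, sq_abs]
  rw [lintegral_mul_const' _ _ ENNReal.ofReal_ne_top, ENNReal.ofReal_mul hs.1.le]
  ring

lemma setLIntegral_one_sub (g : ℝ → ℝ≥0∞) (h : ℝ) :
    ∫⁻ s in Set.Ioo (1 - h) 1, g (1 - s) = ∫⁻ u in Set.Ioo 0 h, g u := by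
  have hmp := Measure.measurePreserving_sub_left (volume : Measure ℝ) 1
  have hemb : MeasurableEmbedding fun s : ℝ => 1 - s :=
    (MeasurableEquiv.subLeft (1 : ℝ)).measurableEmbedding
  rw [← hmp.setLIntegral_comp_preimage_emb hemb g (Set.Ioo 0 h)]
  congr 2
  ext s
  simp only [Set.mem_Ioo, Set.mem_preimage]
  constructor <;> rintro ⟨h1, h2⟩ <;> constructor <;> linarith

lemma lintegral_Ioo_rpow {β h : ℝ} (hβ : -1 < β) (hh : 0 < h) :
    ∫⁻ u in Set.Ioo 0 h, ENNReal.ofReal (u ^ β) = ENNReal.ofReal (h ^ (β + 1) / (β + 1)) := by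
  have h1 := integral_rpow (a := 0) (b := h) (Or.inl hβ)
  rw [Real.zero_rpow (by linarith), sub_zero, intervalIntegral.integral_of_le hh.le] at h1
  rw [setLIntegral_congr Ioo_ae_eq_Ioc, ← h1, ofReal_integral_eq_lintegral_ofReal]
  · exact (intervalIntegral.intervalIntegrable_rpow' hβ).1
  · refine (ae_restrict_iff' measurableSet_Ioc).2 (.of_forall fun u hu => ?_)
    exact Real.rpow_nonneg hu.1.le β

/-- Factor 1-s² = (1+s)(1-s) with 1 ≤ 1+s ≤ 2. The exponent |β| handles both signs of β. -/
lemma one_sub_sq_rpow_bounds {s : ℝ} (hs : s ∈ Set.Ioo (0 : ℝ) 1) (β : ℝ) :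
    2 ^ (-|β|) * (1 - s) ^ β ≤ (1 - s ^ 2) ^ β ∧
      (1 - s ^ 2) ^ β ≤ 2 ^ |β| * (1 - s) ^ β := by
  obtain ⟨hs0, hs1⟩ := hs
  have h1 : 1 - s ^ 2 = (1 + s) * (1 - s) := by ring
  have h2 : (1 : ℝ) ≤ 1 + s := by linarith
  rw [h1, Real.mul_rpow (by linarith) (by linarith)]
  have h3 : (0 : ℝ) ≤ (1 - s) ^ β := Real.rpow_nonneg (by linarith) _
  have h4 : (1 + s) ^ |β| ≤ 2 ^ |β| :=
    Real.rpow_le_rpow (by linarith) (by linarith) (abs_nonneg _)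
  constructor
  · gcongr
    calc (2 : ℝ) ^ (-|β|) ≤ (1 + s) ^ (-|β|) := by
          rw [Real.rpow_neg (by norm_num), Real.rpow_neg (by linarith)]
          gcongr
      _ ≤ (1 + s) ^ β := Real.rpow_le_rpow_of_exponent_le h2 (neg_abs_le β)
  · gcongr
    exact (Real.rpow_le_rpow_of_exponent_le h2 (le_abs_self β)).trans h4

end Polar

/-! ### Upper bounds for the Hardy and Bergman norms. -/

section Upper

open MeasureTheory

lemma one_le_div_one_sub {n : ℕ} (hn : 1 ≤ n) {r : ℝ} (hr0 : 0 ≤ r) (hr : r < 1) :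
    1 ≤ (n : ℝ) / (1 - r) := by
  rw [le_div_iff₀ (by linarith)]
  have : (1 : ℝ) ≤ n := by exact_mod_cast hn
  linarith

lemma le_ofReal_rpow_of_rpow_le {x : ℝ≥0∞} {p C N e : ℝ} (hp : 0 < p) (hC : 0 ≤ C) (hN : 0 ≤ N)
    (h : x ^ p ≤ ENNReal.ofReal (C * N ^ e)) :
    x ≤ ENNReal.ofReal (C ^ (1 / p) * N ^ (e / p)) := by
  rw [← ENNReal.rpow_le_rpow_iff hp, ENNReal.ofReal_rpow_of_nonneg (by positivity) hp.le,
    Real.mul_rpow (by positivity) (by positivity), ← Real.rpow_mul hC, ← Real.rpow_mul hN,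
    one_div_mul_cancel hp.ne', Real.rpow_one, div_mul_cancel₀ _ hp.ne']
  exact h

lemma le_one_of_rpow_one_div_le_one {x : ℝ≥0∞} {p : ℝ} (hp : 0 < p) (h : x ^ (1 / p) ≤ 1) :
    x ≤ 1 := by
  rwa [← ENNReal.one_rpow (1 / p), ENNReal.rpow_le_rpow_iff (by positivity)] at h

theorem supPtakYoung_hardyNorm_le {p : ℝ} (hp : 1 ≤ p) {n : ℕ} (hn : 1 ≤ n) {r : ℝ}
    (hr0 : 0 ≤ r) (hr : r < 1) :
    supPtakYoung (hardyNorm p) n r ≤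
      ENNReal.ofReal ((3 ^ p * 256) ^ (1 / p) * ((n : ℝ) / (1 - r)) ^ (1 / p)) := by
  have hN1 := one_le_div_one_sub hn hr0 hr
  have hp0 : 0 < p := by linarith
  refine iSup_le fun f => iSup_le fun hf => iSup_le fun hN => iSup_le fun σ => iSup_le fun _ =>
    iSup_le fun hσ => iSup_le fun T => iSup_le fun hT => iSup_le fun hm => ?_
  refine le_ofReal_rpow_of_rpow_le hp0 (by positivity) (by positivity) ?_
  set N : ℝ := n / (1 - r) with hNdef
  have hρ : 1 - 1 / (32 * N) ∈ Set.Ico (0 : ℝ) 1 := by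
    have h1 : 0 < 1 / (32 * N) := by positivity
    have h2 : 1 / (32 * N) ≤ 1 := by
      rw [div_le_one (by positivity)]
      linarith
    exact ⟨by linarith, by linarith⟩
  have h := enorm_funcCalc_rpow_le hn hr0 hr hσ hT hm hf le_rfl hρ.2 hp
  rw [← hNdef] at h
  refine h.trans ?_
  rw [Real.rpow_one]
  refine mul_le_of_le_one_right' ?_
  have h1 := (le_iSup₂ (f := fun (ρ : ℝ) (_ : ρ ∈ Set.Ico (0 : ℝ) 1) =>
    ((ENNReal.ofReal (2 * Real.pi))⁻¹ *
      ∫⁻ θ in Set.Ioc 0 (2 * Real.pi), ‖f (circleMap 0 ρ θ)‖ₑ ^ p) ^ (1 / p)) _ hρ).trans hN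
  exact le_one_of_rpow_one_div_le_one hp0 h1

/-- A quantity controlled by the `Lᵖ` means of `f` over all circles of radius at least `1 - h` is
controlled by the Bergman norm of `f`. -/
lemma le_of_forall_circle_le {f : ℂ → ℂ} (hf : ContinuousOn f (Metric.ball 0 1)) {p β : ℝ}
    (hp : 1 ≤ p) (hβ : -1 < β) (hN : bergmanNorm p β f ≤ 1) {y : ℝ≥0∞} {A h : ℝ} (hA : 0 ≤ A)
    (hh0 : 0 < h) (hh1 : h ≤ 1 / 2)
    (hy : ∀ ρ, 1 - h ≤ ρ → ρ < 1 → y ≤ ENNReal.ofReal A * ((ENNReal.ofReal (2 * Real.pi))⁻¹ *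
      ∫⁻ θ in Set.Ioc 0 (2 * Real.pi), ‖f (circleMap 0 ρ θ)‖ₑ ^ p)) :
    y ≤ ENNReal.ofReal (A * (2 ^ |β| * (β + 1) * h⁻¹ ^ (β + 1))) := by
  have hp0 : 0 < p := by linarith
  have hβ1 : 0 < β + 1 := by linarith
  set J : ℝ → ℝ≥0∞ := fun s => ∫⁻ θ in Set.Ioc 0 (2 * Real.pi), ‖f (circleMap 0 s θ)‖ₑ ^ p
    with hJ
  have htot : ∫⁻ s in Set.Ioo (0 : ℝ) 1, ENNReal.ofReal (s * (1 - s ^ 2) ^ β) * J s ≤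
      ENNReal.ofReal Real.pi := by
    rw [← lintegral_bergman_eq hf]
    have h1 := le_one_of_rpow_one_div_le_one hp0 hN
    rw [mul_comm, ← div_eq_mul_inv] at h1
    have h2 := (ENNReal.div_le_iff (by simp [Real.pi_pos]) ENNReal.ofReal_ne_top).1 h1
    rwa [one_mul] at h2
  set D : ℝ≥0∞ := ENNReal.ofReal A * (ENNReal.ofReal (2 * Real.pi))⁻¹ with hD
  have hDtop : D ≠ ∞ := by
    refine ENNReal.mul_ne_top ENNReal.ofReal_ne_top (ENNReal.inv_ne_top.2 ?_)
    simp [Real.pi_pos]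
  set c : ℝ := 2 ^ (-|β|) / 2 with hc
  have hc0 : 0 < c := by positivity
  -- Since s ≥ 1/2 near the boundary, the polar weight dominates c(1-s)^β; the 1/2 in c absorbs the
  -- Jacobian s.
  have hpt : ∀ s ∈ Set.Ioo (1 - h) 1, ENNReal.ofReal (c * (1 - s) ^ β) * y ≤
      D * (ENNReal.ofReal (s * (1 - s ^ 2) ^ β) * J s) := by
    intro s hs
    have hs0 : 1 / 2 ≤ s := by linarith [hs.1]
    have h1 : c * (1 - s) ^ β ≤ s * (1 - s ^ 2) ^ β := by
      have h2 := (one_sub_sq_rpow_bounds ⟨by linarith, hs.2⟩ β).1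
      have h3 : 0 ≤ 2 ^ (-|β|) * (1 - s) ^ β :=
        mul_nonneg (by positivity) (Real.rpow_nonneg (by linarith [hs.2]) _)
      calc c * (1 - s) ^ β = 1 / 2 * (2 ^ (-|β|) * (1 - s) ^ β) := by rw [hc]; ring
        _ ≤ s * (1 - s ^ 2) ^ β := by gcongr
    calc _ ≤ ENNReal.ofReal (s * (1 - s ^ 2) ^ β) * (ENNReal.ofReal A *
          ((ENNReal.ofReal (2 * Real.pi))⁻¹ * J s)) := by
          gcongr
          exact hy s hs.1.le hs.2
      _ = _ := by rw [hD]; ring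
  have hint : ENNReal.ofReal (c * (h ^ (β + 1) / (β + 1))) * y ≤ ENNReal.ofReal (A / 2) := by
    have h1 : ∫⁻ s in Set.Ioo (1 - h) 1, ENNReal.ofReal (c * (1 - s) ^ β) * y =
        ENNReal.ofReal (c * (h ^ (β + 1) / (β + 1))) * y := by
      rw [setLIntegral_one_sub (fun u => ENNReal.ofReal (c * u ^ β) * y), lintegral_mul_const _
        (by fun_prop)]
      simp only [ENNReal.ofReal_mul hc0.le]
      rw [lintegral_const_mul' _ _ ENNReal.ofReal_ne_top, lintegral_Ioo_rpow hβ hh0]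
    rw [← h1]
    calc _ ≤ ∫⁻ s in Set.Ioo (1 - h) 1, D * (ENNReal.ofReal (s * (1 - s ^ 2) ^ β) * J s) :=
          setLIntegral_mono' measurableSet_Ioo hpt
      _ ≤ ∫⁻ s in Set.Ioo 0 1, D * (ENNReal.ofReal (s * (1 - s ^ 2) ^ β) * J s) :=
          lintegral_mono_set (Set.Ioo_subset_Ioo_left (by linarith))
      _ ≤ D * ENNReal.ofReal Real.pi := by
          rw [lintegral_const_mul' _ _ hDtop]
          gcongr
      _ = ENNReal.ofReal (A / 2) := by
          rw [hD, ← ENNReal.ofReal_inv_of_pos (by positivity), ← ENNReal.ofReal_mul hA,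
            ← ENNReal.ofReal_mul (by positivity)]
          congr 1
          field_simp
  have hk : 0 < c * (h ^ (β + 1) / (β + 1)) := by positivity
  rw [mul_comm, ← ENNReal.le_div_iff_mul_le (Or.inl (by simpa using hk))
    (Or.inl ENNReal.ofReal_ne_top), ← ENNReal.ofReal_div_of_pos hk] at hint
  refine hint.trans_eq ?_
  congr 1
  rw [hc, Real.rpow_neg (by norm_num), Real.inv_rpow hh0.le]
  field_simp

theorem supPtakYoung_bergmanNorm_le {p β : ℝ} (hp : 1 ≤ p) (hβ : -1 < β) {n : ℕ} (hn : 1 ≤ n)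
    {r : ℝ} (hr0 : 0 ≤ r) (hr : r < 1) :
    supPtakYoung (bergmanNorm p β) n r ≤
      ENNReal.ofReal ((3 ^ p * 256 * (2 ^ |β| * 32 ^ (β + 1) * (β + 1))) ^ (1 / p) *
        ((n : ℝ) / (1 - r)) ^ ((2 + β) / p)) := by
  have hN1 := one_le_div_one_sub hn hr0 hr
  have hp0 : 0 < p := by linarith
  have hβ1 : 0 < β + 1 := by linarith
  refine iSup_le fun f => iSup_le fun hf => iSup_le fun hN => iSup_le fun σ => iSup_le fun _ =>
    iSup_le fun hσ => iSup_le fun T => iSup_le fun hT => iSup_le fun hm => ?_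
  refine le_ofReal_rpow_of_rpow_le hp0 (by positivity) (by positivity) ?_
  set N : ℝ := n / (1 - r) with hNdef
  set h : ℝ := 1 / (32 * N) with hh
  have hh0 : 0 < h := by positivity
  have hh1 : h ≤ 1 / 2 := by
    rw [hh]
    exact one_div_le_one_div_of_le (by norm_num) (by linarith)
  -- The circle estimate contributes one factor N and the averaging over width h = 1/(32N)
  -- contributes N^{β+1}, up to constants.
  have key := le_of_forall_circle_le hf.continuousOn hp hβ hN (A := 3 ^ p * 256 * N)
    (by positivity) hh0 hh1 fun ρ hρ1 hρ =>
      enorm_funcCalc_rpow_le hn hr0 hr hσ hT hm hf hρ1 hρ hp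
  refine key.trans_eq ?_
  congr 1
  have h2 : N ^ (2 + β) = N * N ^ (β + 1) := by
    rw [(by ring : 2 + β = 1 + (β + 1)), Real.rpow_add (by positivity), Real.rpow_one]
  rw [hh, one_div, inv_inv, Real.mul_rpow (by norm_num) (by positivity), h2]
  ring

end Upper

/-! ### The Möbius-transformed Jordan block. -/

section Shift

variable {k : ℕ}

/-- The nilpotent Jordan block. -/
def shift (k : ℕ) : Matrix (Fin (k + 1)) (Fin (k + 1)) ℂ :=
  Matrix.of fun i j => if (i : ℕ) = j + 1 then 1 else 0

/-- The matrix `∑ cʲ Jʲ = (1 - c J)⁻¹`, where `J` is the nilpotent Jordan block. -/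
def shiftGeom (k : ℕ) (c : ℂ) : Matrix (Fin (k + 1)) (Fin (k + 1)) ℂ :=
  Matrix.of fun i j => if j ≤ i then c ^ ((i : ℕ) - j) else 0

lemma shift_zero_apply (j : Fin (k + 1)) : shift k 0 j = 0 := by
  simp [shift]

lemma shift_succ_apply (i : Fin k) (j : Fin (k + 1)) :
    shift k i.succ j = if j = i.castSucc then 1 else 0 := by
  simp only [shift, Matrix.of_apply, Fin.val_succ, Nat.add_right_cancel_iff, Fin.ext_iff,
    Fin.val_castSucc, eq_comm]

lemma shift_mul_zero_apply (B : Matrix (Fin (k + 1)) (Fin (k + 1)) ℂ) (l : Fin (k + 1)) :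
    (shift k * B) 0 l = 0 := by
  simp [Matrix.mul_apply, shift_zero_apply]

lemma shift_mul_succ_apply (B : Matrix (Fin (k + 1)) (Fin (k + 1)) ℂ) (i : Fin k)
    (l : Fin (k + 1)) : (shift k * B) i.succ l = B i.castSucc l := by
  simp [Matrix.mul_apply, shift_succ_apply]

lemma shift_mulVec_zero (x : Fin (k + 1) → ℂ) : (shift k).mulVec x 0 = 0 := by
  simp [Matrix.mulVec, dotProduct, shift_zero_apply]

lemma shift_mulVec_succ (x : Fin (k + 1) → ℂ) (i : Fin k) :
    (shift k).mulVec x i.succ = x i.castSucc := by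
  simp [Matrix.mulVec, dotProduct, shift_succ_apply]

lemma shift_pow_apply (m : ℕ) (i l : Fin (k + 1)) :
    (shift k ^ m) i l = if (i : ℕ) = l + m then 1 else 0 := by
  induction m generalizing i with
  | zero => simp [Matrix.one_apply, Fin.ext_iff]
  | succ m ih =>
    rw [pow_succ']
    refine Fin.cases ?_ (fun i => ?_) i
    · rw [shift_mul_zero_apply, if_neg (by simp)]
    · rw [shift_mul_succ_apply, ih]
      simp [← add_assoc]

lemma shift_pow_succ_eq_zero : shift k ^ (k + 1) = 0 := by
  ext i l
  rw [shift_pow_apply, if_neg (by omega)]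
  rfl

lemma shift_pow_ne_zero : shift k ^ k ≠ 0 := by
  intro h
  have := congrFun (congrFun h (Fin.last k)) 0
  simp [shift_pow_apply] at this

lemma one_sub_smul_shift_mul_shiftGeom (c : ℂ) : (1 - c • shift k) * shiftGeom k c = 1 := by
  rw [sub_mul, one_mul, Matrix.smul_mul]
  ext i l
  rw [Matrix.sub_apply, Matrix.smul_apply]
  refine Fin.cases ?_ (fun i => ?_) i
  · rw [shift_mul_zero_apply]
    simp only [shiftGeom, Matrix.of_apply, Matrix.one_apply, eq_comm, Fin.le_zero_iff]
    simp
  · rw [shift_mul_succ_apply]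
    simp only [shiftGeom, Matrix.of_apply, Matrix.one_apply, Fin.le_def, Fin.ext_iff,
      Fin.val_succ, Fin.val_castSucc, smul_eq_mul]
    rcases lt_trichotomy ((i : ℕ) + 1) l with h | h | h
    · rw [if_neg (by omega), if_neg (by omega), if_neg (by omega)]
      simp
    · rw [if_pos (by omega), if_neg (by omega), if_pos h, h]
      simp
    · rw [if_pos (by omega), if_pos (by omega), if_neg (by omega),
        (by omega : (i : ℕ) + 1 - l = (i - l) + 1), pow_succ']
      simp

lemma shiftGeom_mul_one_sub_smul_shift (c : ℂ) : shiftGeom k c * (1 - c • shift k) = 1 :=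
  mul_eq_one_comm.1 (one_sub_smul_shift_mul_shiftGeom c)

lemma commute_shift_shiftGeom (c : ℂ) : Commute (shift k) (shiftGeom k c) := by
  have h1 := one_sub_smul_shift_mul_shiftGeom (k := k) c
  have h2 := shiftGeom_mul_one_sub_smul_shift (k := k) c
  have h3 : Commute (shift k) (1 - c • shift k) :=
    (Commute.one_right _).sub_right ((Commute.refl _).smul_right c)
  calc shift k * shiftGeom k c
      = shiftGeom k c * (1 - c • shift k) * (shift k * shiftGeom k c) := by rw [h2, one_mul]
    _ = shiftGeom k c * (shift k * (1 - c • shift k)) * shiftGeom k c := by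
        rw [h3.eq]
        simp only [mul_assoc]
    _ = shiftGeom k c * shift k := by
        simp only [mul_assoc]
        rw [h1, mul_one]

/-- The Möbius transform `(J + r) (1 + r J)⁻¹` of the nilpotent Jordan block `J`. -/
def mobiusShift (k : ℕ) (r : ℝ) : Matrix (Fin (k + 1)) (Fin (k + 1)) ℂ :=
  (shift k + (r : ℂ) • 1) * shiftGeom k (-r)

lemma mobiusShift_mul (r : ℝ) :
    mobiusShift k r * (1 + (r : ℂ) • shift k) = shift k + (r : ℂ) • 1 := by
  have h := shiftGeom_mul_one_sub_smul_shift (k := k) (-(r : ℂ))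
  rw [neg_smul, sub_neg_eq_add] at h
  rw [mobiusShift, mul_assoc, h, mul_one]

lemma mobiusShift_sub (r : ℝ) :
    mobiusShift k r - (r : ℂ) • 1 = ((1 - r ^ 2 : ℝ) : ℂ) • (shift k * shiftGeom k (-r)) := by
  have h := one_sub_smul_shift_mul_shiftGeom (k := k) (-(r : ℂ))
  rw [neg_smul, sub_neg_eq_add] at h
  calc mobiusShift k r - (r : ℂ) • 1
      = (shift k + (r : ℂ) • 1) * shiftGeom k (-r) -
          (r : ℂ) • ((1 + (r : ℂ) • shift k) * shiftGeom k (-r)) := by rw [h, mobiusShift]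
    _ = _ := by
        rw [← Matrix.smul_mul, ← sub_mul, ← Matrix.smul_mul]
        congr 1
        push_cast
        module

lemma mobiusShift_sub_pow (r : ℝ) (m : ℕ) :
    (mobiusShift k r - (r : ℂ) • 1) ^ m =
      (((1 - r ^ 2 : ℝ) : ℂ) ^ m) • (shift k ^ m * shiftGeom k (-r) ^ m) := by
  rw [mobiusShift_sub, _root_.smul_pow, (commute_shift_shiftGeom _).mul_pow]

/-- T - r is J times an invertible matrix commuting with J, so it has the same nilpotency index k+1
as J. -/
lemma minpoly_mobiusShift {r : ℝ} (hr0 : 0 ≤ r) (hr : r < 1) :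
    minpoly ℂ (mobiusShift k r) = monicPoly fun _ : Fin (k + 1) => (r : ℂ) := by
  have haeval : ∀ m : ℕ, aeval (mobiusShift k r) ((X - C (r : ℂ)) ^ m) =
      (mobiusShift k r - (r : ℂ) • 1) ^ m := by
    intro m
    rw [map_pow, map_sub, aeval_X, aeval_C, Algebra.algebraMap_eq_smul_one]
  have hdvd : minpoly ℂ (mobiusShift k r) ∣ (X - C (r : ℂ)) ^ (k + 1) := by
    refine minpoly.dvd _ _ ?_
    rw [haeval, mobiusShift_sub_pow, shift_pow_succ_eq_zero]
    simp
  obtain ⟨m, hm, hassoc⟩ := (dvd_prime_pow (prime_X_sub_C (r : ℂ)) _).1 hdvd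
  have heq : minpoly ℂ (mobiusShift k r) = (X - C (r : ℂ)) ^ m :=
    eq_of_monic_of_associated (minpoly.monic (Matrix.isIntegral _)) ((monic_X_sub_C _).pow m)
      hassoc
  have hmk : m = k + 1 := by
    by_contra hne
    have hmk : m ≤ k := by omega
    have h0 : (mobiusShift k r - (r : ℂ) • 1) ^ m = 0 := by
      rw [← haeval, ← heq, minpoly.aeval]
    have h1 : (mobiusShift k r - (r : ℂ) • 1) ^ k = 0 := pow_eq_zero_of_le hmk h0
    rw [mobiusShift_sub_pow] at h1
    have hc : ((1 - r ^ 2 : ℝ) : ℂ) ^ k ≠ 0 := by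
      refine pow_ne_zero _ (Complex.ofReal_ne_zero.2 ?_)
      nlinarith
    have h2 := (smul_eq_zero.1 h1).resolve_left hc
    have hu : IsUnit (shiftGeom k (-r)) :=
      ⟨⟨_, _, shiftGeom_mul_one_sub_smul_shift _, one_sub_smul_shift_mul_shiftGeom _⟩, rfl⟩
    exact shift_pow_ne_zero ((hu.pow k).mul_left_eq_zero.1 h2)
  rw [heq, hmk, monicPoly, Finset.prod_const, Finset.card_univ, Fintype.card_fin]

open scoped Matrix.Norms.L2Operator

lemma norm_shift_apply_le (z : EuclideanSpace ℂ (Fin (k + 1))) :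
    ‖Matrix.toEuclideanCLM (n := Fin (k + 1)) (𝕜 := ℂ) (shift k) z‖ ≤ ‖z‖ := by
  refine (sq_le_sq₀ (norm_nonneg _) (norm_nonneg _)).1 ?_
  rw [EuclideanSpace.norm_sq_eq, EuclideanSpace.norm_sq_eq, Fin.sum_univ_succ]
  simp only [Matrix.ofLp_toEuclideanCLM, shift_mulVec_zero, shift_mulVec_succ]
  rw [Fin.sum_univ_castSucc (fun i => ‖z.ofLp i‖ ^ 2)]
  simp

/-- With x = (1+rJ)z one has Tx = (J+r)z. The identity `norm_sub_conj_smul_sq` at c = -r then gives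
‖x‖² - ‖Tx‖² = (1-r²)(‖z‖² - ‖Jz‖²) ≥ 0. -/
lemma norm_mobiusShift_le {r : ℝ} (hr0 : 0 ≤ r) (hr : r < 1) : ‖mobiusShift k r‖ ≤ 1 := by
  rw [← Matrix.l2_opNorm_toEuclideanCLM]
  refine ContinuousLinearMap.opNorm_le_bound _ zero_le_one fun x => ?_
  rw [one_mul]
  set Φ := Matrix.toEuclideanCLM (n := Fin (k + 1)) (𝕜 := ℂ) with hΦ
  set z := Φ (shiftGeom k (-r)) x with hz
  have hx : x = z + (r : ℂ) • Φ (shift k) z := by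
    have h := one_sub_smul_shift_mul_shiftGeom (k := k) (-(r : ℂ))
    rw [neg_smul, sub_neg_eq_add] at h
    have h1 := congrArg (fun A => Φ A x) h
    simp only [map_mul, map_add, map_one, map_smul, mul_apply_eq_comp, add_apply, smul_apply,
      one_apply_eq_self] at h1
    exact h1.symm
  have hT : Φ (mobiusShift k r) x = Φ (shift k) z + (r : ℂ) • z := by
    rw [mobiusShift, map_mul, map_add, map_smul, map_one]
    rfl
  have h := norm_sub_conj_smul_sq (-(r : ℂ)) z (Φ (shift k) z)
  rw [map_neg, Complex.conj_ofReal, neg_smul, neg_smul, sub_neg_eq_add, sub_neg_eq_add, ← hx,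
    ← hT, norm_neg, Complex.norm_real, Real.norm_of_nonneg hr0] at h
  have h1 := norm_shift_apply_le z
  have h2 : ‖Φ (shift k) z‖ ^ 2 ≤ ‖z‖ ^ 2 := by gcongr
  refine (sq_le_sq₀ (norm_nonneg _) (norm_nonneg _)).1 ?_
  nlinarith [mul_nonneg (by nlinarith : 0 ≤ 1 - r ^ 2) (sub_nonneg.2 h2)]

end Shift

/-! ### Large resolvent powers and the test functions. -/

section LowerBound

variable {k : ℕ}

lemma sum_ite_le_eq_sum_range (g : ℕ → ℝ) (i : Fin (k + 1)) :
    ∑ l : Fin (k + 1), (if l ≤ i then g l else 0) = ∑ l ∈ Finset.range (i + 1), g l := by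
  have h := Fin.sum_univ_eq_sum_range (fun l => if l ≤ (i : ℕ) then g l else 0) (k + 1)
  simp only [Fin.le_def]
  rw [h, ← Finset.sum_filter]
  congr 1
  ext l
  simp only [Finset.mem_filter, Finset.mem_range]
  omega

/-- Each factor (1-κJ)⁻¹ takes weighted partial sums, which raise the binomial coefficient by the
hockey-stick identity. The factor 1+rJ only adds nonnegative terms. -/
lemma exists_pow_mulVec_one {r κ : ℝ} (hr0 : 0 ≤ r) (hκ : 0 ≤ κ) (hκ1 : κ ≤ 1) (m : ℕ) :
    ∃ w : Fin (k + 1) → ℝ,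
      (((1 + (r : ℂ) • shift k) * shiftGeom k κ) ^ m).mulVec 1 = (fun i => (w i : ℂ)) ∧
      ∀ i : Fin (k + 1), κ ^ (i : ℕ) * (((i : ℕ) + m).choose m : ℝ) ≤ w i := by
  induction m with
  | zero =>
    refine ⟨1, ?_, fun i => ?_⟩
    · ext i
      simp
    · simpa using pow_le_one₀ hκ hκ1
  | succ m ih =>
    obtain ⟨w, hw, hwle⟩ := ih
    have hw0 : ∀ i, 0 ≤ w i := fun i => le_trans (by positivity) (hwle i)
    set a : Fin (k + 1) → ℝ := fun i => ∑ l, if l ≤ i then κ ^ ((i : ℕ) - l) * w l else 0 with ha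
    have ha0 : ∀ i, 0 ≤ a i := fun i => Finset.sum_nonneg fun l _ => by
      have := hw0 l
      split_ifs <;> positivity
    have haw : (shiftGeom k κ).mulVec (fun i => (w i : ℂ)) = fun i => (a i : ℂ) := by
      ext i
      simp only [Matrix.mulVec, dotProduct, shiftGeom, Matrix.of_apply, ha, Complex.ofReal_sum]
      refine Finset.sum_congr rfl fun l _ => ?_
      split_ifs <;> simp
    have hale : ∀ i : Fin (k + 1),
        κ ^ (i : ℕ) * (((i : ℕ) + (m + 1)).choose (m + 1) : ℝ) ≤ a i := by
      intro i
      have h1 := Nat.sum_range_add_choose i m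
      rw [← add_assoc, ← h1, Nat.cast_sum, Finset.mul_sum,
        ← sum_ite_le_eq_sum_range (fun l => κ ^ (i : ℕ) * ((l + m).choose m : ℝ)) i]
      refine Finset.sum_le_sum fun l _ => ?_
      split_ifs with hl
      · calc κ ^ (i : ℕ) * (((l : ℕ) + m).choose m : ℝ)
            = κ ^ ((i : ℕ) - l) * (κ ^ (l : ℕ) * (((l : ℕ) + m).choose m : ℝ)) := by
              rw [← mul_assoc, ← pow_add, Nat.sub_add_cancel hl]
          _ ≤ _ := by
              gcongr
              exact hwle l
      · exact le_rfl
    refine ⟨fun i => a i + r * ((shift k).mulVec (fun i => (a i : ℂ)) i).re, ?_, fun i => ?_⟩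
    · rw [pow_succ', ← Matrix.mulVec_mulVec, hw, ← Matrix.mulVec_mulVec, haw, Matrix.add_mulVec,
        Matrix.one_mulVec, Matrix.smul_mulVec]
      ext i
      refine Fin.cases ?_ (fun i => ?_) i
      · simp [shift_mulVec_zero]
      · simp [shift_mulVec_succ]
    · refine (hale i).trans ?_
      refine Fin.cases ?_ (fun i => ?_) i
      · simp [shift_mulVec_zero]
      · simp only [shift_mulVec_succ, Complex.ofReal_re]
        have := mul_nonneg hr0 (ha0 i.castSucc)
        linarith

open scoped Matrix.Norms.L2Operator

lemma norm_sum_mulVec_one_le {n : ℕ} (A : Matrix (Fin n) (Fin n) ℂ) :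
    ‖∑ i, A.mulVec 1 i‖ ≤ n * ‖A‖ := by
  set u : EuclideanSpace ℂ (Fin n) := WithLp.toLp 2 1 with hu
  have hun : ‖u‖ ^ 2 = n := by
    rw [EuclideanSpace.norm_sq_eq]
    simp [hu]
  set y : EuclideanSpace ℂ (Fin n) := WithLp.toLp 2 (A.mulVec 1) with hy
  have h1 : ‖y‖ ≤ ‖A‖ * ‖u‖ := Matrix.l2_opNorm_mulVec A u
  have h2 : ∑ i, A.mulVec 1 i = ⟪u, y⟫_ℂ := by
    simp [PiLp.inner_apply, hu, hy]
  rw [h2]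
  calc ‖⟪u, y⟫_ℂ‖ ≤ ‖u‖ * ‖y‖ := norm_inner_le_norm _ _
    _ ≤ ‖u‖ * (‖A‖ * ‖u‖) := by gcongr
    _ = ‖u‖ ^ 2 * ‖A‖ := by ring
    _ = _ := by rw [hun]

lemma half_le_pow_of_le {κ : ℝ} {n i : ℕ} (hn : 1 ≤ n) (hi : i ≤ n)
    (h1 : 1 - 1 / (2 * n) ≤ κ) : 1 / 2 ≤ κ ^ i := by
  have hn' : (1 : ℝ) ≤ n := by exact_mod_cast hn
  have hb : 1 / (2 * (n : ℝ)) ≤ 1 / 2 := by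
    apply one_div_le_one_div_of_le <;> linarith
  have h2 := one_add_mul_le_pow (a := -(1 / (2 * (n : ℝ)))) (by linarith) i
  have h3 : (i : ℝ) * (1 / (2 * n)) ≤ 1 / 2 := by
    rw [mul_one_div, div_le_div_iff₀ (by positivity) (by norm_num)]
    have : (i : ℝ) ≤ n := by exact_mod_cast hi
    linarith
  calc (1 : ℝ) / 2 ≤ 1 + i * -(1 / (2 * (n : ℝ))) := by linarith
    _ ≤ (1 + -(1 / (2 * (n : ℝ)))) ^ i := h2
    _ ≤ κ ^ i := by
      gcongr
      · linarith
      · linarith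

/-- The sum of all entries is at most n times the norm. It is at least half of C(n+m, m+1), because
κⁱ ≥ 1/2 for i < n. -/
lemma le_norm_pow {r κ : ℝ} (hr0 : 0 ≤ r) (hκ : 1 - 1 / (2 * ((k + 1 : ℕ) : ℝ)) ≤ κ)
    (hκ1 : κ ≤ 1) (m : ℕ) :
    ((k + 1 : ℕ) : ℝ) ^ m / (2 * (m + 1).factorial) ≤
      ‖((1 + (r : ℂ) • shift k) * shiftGeom k κ) ^ m‖ := by
  set n : ℕ := k + 1 with hn
  have hn' : (1 : ℝ) ≤ (n : ℝ) := by exact_mod_cast (by omega : 1 ≤ n)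
  have hκ0 : 0 ≤ κ := by
    have hb : 1 / (2 * (n : ℝ)) ≤ 1 / 2 := by
      apply one_div_le_one_div_of_le <;> linarith
    linarith
  obtain ⟨w, hw, hwle⟩ := exists_pow_mulVec_one (k := k) hr0 hκ0 hκ1 m
  have h := norm_sum_mulVec_one_le (((1 + (r : ℂ) • shift k) * shiftGeom k κ) ^ m)
  rw [hw, ← Complex.ofReal_sum, Complex.norm_real] at h
  have h1 : 1 / 2 * ((n + m).choose (m + 1) : ℝ) ≤ ∑ i, w i := by
    have h2 : ((n + m).choose (m + 1) : ℝ) = ∑ i : Fin n, (((i : ℕ) + m).choose m : ℝ) := by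
      rw [Fin.sum_univ_eq_sum_range (fun i => ((i + m).choose m : ℝ)) n, hn, ← Nat.cast_sum,
        Nat.sum_range_add_choose, add_right_comm]
    rw [h2, Finset.mul_sum]
    refine Finset.sum_le_sum fun i _ => le_trans ?_ (hwle i)
    gcongr
    exact half_le_pow_of_le (by omega) i.2.le hκ
  have h3 : (n : ℝ) ^ (m + 1) / (m + 1).factorial ≤ ((n + m).choose (m + 1) : ℝ) := by
    have := Nat.pow_le_choose (α := ℝ) (m + 1) (n + m)
    rwa [(by omega : n + m + 1 - (m + 1) = n)] at this
  have h4 : 1 / 2 * ((n : ℝ) ^ (m + 1) / (m + 1).factorial) ≤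
      n * ‖((1 + (r : ℂ) • shift k) * shiftGeom k κ) ^ m‖ := by
    calc _ ≤ 1 / 2 * ((n + m).choose (m + 1) : ℝ) := by gcongr
      _ ≤ ∑ i, w i := h1
      _ ≤ _ := (le_abs_self _).trans h
  refine le_of_mul_le_mul_left (le_trans (le_of_eq ?_) h4) (by linarith : (0 : ℝ) < n)
  rw [pow_succ]
  ring

/-- The test function `c (1 - ρ z)^{-(m+1)}`. -/
noncomputable def peak (c ρ : ℝ) (m : ℕ) (z : ℂ) : ℂ := c * (1 / (1 - ρ * z) ^ (m + 1))

lemma one_sub_mul_ne_zero {ρ : ℝ} (hρ0 : 0 ≤ ρ) (hρ : ρ < 1) {z : ℂ} (hz : ‖z‖ < 1) :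
    1 - ρ * z ≠ 0 := by
  intro h
  have h1 : ‖(ρ : ℂ) * z‖ = 1 := by
    rw [← sub_eq_zero.1 h, norm_one]
  rw [norm_mul, Complex.norm_real, Real.norm_of_nonneg hρ0] at h1
  nlinarith [norm_nonneg z]

lemma differentiableOn_peak (c : ℝ) {ρ : ℝ} (hρ0 : 0 ≤ ρ) (hρ : ρ < 1) (m : ℕ) :
    DifferentiableOn ℂ (peak c ρ m) (Metric.ball 0 1) := by
  intro z hz
  have : (1 - (ρ : ℂ) * z) ^ (m + 1) ≠ 0 :=
    pow_ne_zero _ (one_sub_mul_ne_zero hρ0 hρ (by simpa using hz))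
  refine DifferentiableAt.differentiableWithinAt ?_
  unfold peak
  fun_prop (disch := assumption)

lemma iteratedDeriv_peak (c : ℝ) {ρ : ℝ} (hρ0 : 0 ≤ ρ) (hρ : ρ < 1) (m j : ℕ) :
    iteratedDeriv j (peak c ρ m) 0 / (j.factorial : ℂ) =
      c * (((j + m).choose m : ℂ) * (ρ : ℂ) ^ j) := by
  have han : AnalyticAt ℂ (peak c ρ m) 0 :=
    (differentiableOn_peak c hρ0 hρ m).analyticAt (Metric.ball_mem_nhds 0 one_pos)
  have h1 := han.hasFPowerSeriesAt
  have h2 : HasFPowerSeriesAt (peak c ρ m) (FormalMultilinearSeries.ofScalars ℂ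
      fun j : ℕ => (c : ℂ) * (((j + m).choose m : ℂ) * (ρ : ℂ) ^ j)) 0 := by
    rw [hasFPowerSeriesAt_iff]
    filter_upwards [Metric.ball_mem_nhds (0 : ℂ) one_pos] with z hz
    rw [mem_ball_zero_iff] at hz
    have hlt : ‖(ρ : ℂ) * z‖ < 1 := by
      rw [norm_mul, Complex.norm_real, Real.norm_of_nonneg hρ0]
      nlinarith [norm_nonneg z]
    have h3 := (hasSum_choose_mul_geometric_of_norm_lt_one m hlt).mul_left (c : ℂ)
    rw [zero_add]
    refine h3.congr_fun fun j => ?_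
    simp only [FormalMultilinearSeries.coeff_ofScalars, smul_eq_mul, mul_pow]
    ring
  have h4 := h1.eq_formalMultilinearSeries h2
  have h5 := congrArg (fun q => FormalMultilinearSeries.coeff q j) h4
  simpa only [FormalMultilinearSeries.coeff_ofScalars] using h5

/-- The negative binomial series converges in norm as ‖ρT‖ < 1, so f(T) is a scaled power of the
resolvent. -/
lemma funcCalc_peak (c : ℝ) {ρ : ℝ} (hρ0 : 0 ≤ ρ) (hρ : ρ < 1) (m : ℕ) {n : ℕ}
    {T W : Matrix (Fin n) (Fin n) ℂ} (hT : ‖T‖ ≤ 1) (hW : (1 - (ρ : ℂ) • T) * W = 1) :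
    funcCalc (peak c ρ m) T = (c : ℂ) • W ^ (m + 1) := by
  have hlt : ‖(ρ : ℂ) • T‖ < 1 := by
    rw [norm_smul, Complex.norm_real, Real.norm_of_nonneg hρ0]
    exact (mul_le_of_le_one_right hρ0 hT).trans_lt hρ
  have h := (hasSum_choose_mul_geometric_of_norm_lt_one' m hlt).const_smul (c : ℂ)
  have hinv : Ring.inverse (1 - (ρ : ℂ) • T) = W := by
    rw [← Matrix.nonsing_inv_eq_ringInverse, Matrix.inv_eq_right_inv hW]
  rw [hinv] at h
  rw [← h.tsum_eq, funcCalc]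
  refine tsum_congr fun j => ?_
  rw [iteratedDeriv_peak c hρ0 hρ, _root_.smul_pow, mul_smul, mul_smul, Nat.cast_smul_eq_nsmul,
    nsmul_eq_mul]

theorem le_supPtakYoung {n : ℕ} (hn : 1 ≤ n) {r : ℝ} (hr0 : 0 ≤ r) (hr : r < 1) {c ρ : ℝ}
    (hc : 0 ≤ c) (hρ : ρ = 1 - (1 - r) / (4 * n)) (m : ℕ) {ν : (ℂ → ℂ) → ℝ≥0∞}
    (hν : ν (peak c ρ m) ≤ 1) :
    ENNReal.ofReal (c / (2 ^ (m + 2) * (m + 2).factorial) * ((n : ℝ) / (1 - r)) ^ (m + 1)) ≤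
      supPtakYoung ν n r := by
  obtain ⟨k, rfl⟩ : ∃ k, n = k + 1 := ⟨n - 1, by omega⟩
  set n : ℕ := k + 1 with hnk
  have hn' : (1 : ℝ) ≤ n := by exact_mod_cast hn
  have hr1 : 0 < 1 - r := by linarith
  set h : ℝ := (1 - r) / (4 * n) with hh
  have hh0 : 0 < h := by positivity
  have hh1 : h ≤ (1 - r) / 4 := by
    rw [hh]
    gcongr
    linarith
  have hρ0 : 0 ≤ ρ := by linarith
  have hρ1 : ρ < 1 := by linarith
  have hρr : r ≤ ρ := by linarith
  have hd1 : 1 - r ≤ 1 - ρ * r := by nlinarith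
  have hd2 : 1 - ρ * r ≤ 2 * (1 - r) := by
    rw [hρ]
    nlinarith
  have hd0 : 0 < 1 - ρ * r := by linarith
  -- κ is the image of ρ under the Möbius map sending r to 0. With 1-ρ = (1-r)/(4n) it satisfies 1-κ
  -- ≤ 1/(2n), as `le_norm_pow` requires.
  set κ : ℝ := (ρ - r) / (1 - ρ * r) with hκ
  have h1κ : 1 - κ = h * (1 + r) / (1 - ρ * r) := by
    rw [hκ, hρ]
    rw [hρ] at hd0
    field_simp
    ring
  have hκ2 : κ ≤ 1 := by
    have : 0 ≤ h * (1 + r) / (1 - ρ * r) := by positivity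
    linarith
  have hκ1 : 1 - 1 / (2 * (n : ℝ)) ≤ κ := by
    have h2 : h * (1 + r) / (1 - ρ * r) ≤ h * 2 / (1 - r) := by
      gcongr
      linarith
    have h3 : h * 2 / (1 - r) = 1 / (2 * (n : ℝ)) := by
      rw [hh]
      field_simp
      norm_num
    linarith
  set V : Matrix (Fin n) (Fin n) ℂ := (1 + (r : ℂ) • shift k) * shiftGeom k κ with hV
  have hW : (1 - (ρ : ℂ) • mobiusShift k r) * (((1 - ρ * r : ℝ) : ℂ)⁻¹ • V) = 1 := by
    have hdc : ((1 - ρ * r : ℝ) : ℂ) ≠ 0 := Complex.ofReal_ne_zero.2 hd0.ne'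
    have h1 : (1 - (ρ : ℂ) • mobiusShift k r) * (1 + (r : ℂ) • shift k) =
        ((1 - ρ * r : ℝ) : ℂ) • (1 - (κ : ℂ) • shift k) := by
      have h2 : ((1 - ρ * r : ℝ) : ℂ) * (κ : ℂ) = ρ - r := by
        rw [← Complex.ofReal_mul, hκ, mul_div_cancel₀ _ hd0.ne']
        push_cast
        rfl
      rw [sub_mul, one_mul, Matrix.smul_mul, mobiusShift_mul, smul_sub, smul_smul, h2]
      push_cast
      module
    rw [Matrix.mul_smul, hV, ← mul_assoc, h1, Matrix.smul_mul, one_sub_smul_shift_mul_shiftGeom,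
      smul_smul, inv_mul_cancel₀ hdc, one_smul]
  have hfc := funcCalc_peak c hρ0 hρ1 m (norm_mobiusShift_le hr0 hr) hW
  have hnorm : c / (2 ^ (m + 2) * (m + 2).factorial) * ((n : ℝ) / (1 - r)) ^ (m + 1) ≤
      ‖funcCalc (peak c ρ m) (mobiusShift k r)‖ := by
    rw [hfc, norm_smul, _root_.smul_pow, norm_smul, norm_pow, norm_inv, Complex.norm_real,
      Complex.norm_real, Real.norm_of_nonneg hc, Real.norm_of_nonneg hd0.le]
    have hVn := le_norm_pow (k := k) hr0 hκ1 hκ2 (m + 1)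
    calc c / (2 ^ (m + 2) * (m + 2).factorial) * ((n : ℝ) / (1 - r)) ^ (m + 1)
        = c * ((2 * (1 - r))⁻¹ ^ (m + 1) * ((n : ℝ) ^ (m + 1) / (2 * (m + 2).factorial))) := by
          rw [div_pow, mul_inv, mul_pow, inv_pow, inv_pow]
          field_simp
          ring
      _ ≤ c * ((1 - ρ * r)⁻¹ ^ (m + 1) * ‖V ^ (m + 1)‖) := by
          gcongr
  have hfin : ENNReal.ofReal (c / (2 ^ (m + 2) * (m + 2).factorial) *
      ((n : ℝ) / (1 - r)) ^ (m + 1)) ≤ ‖funcCalc (peak c ρ m) (mobiusShift k r)‖ₑ := by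
    rw [← ofReal_norm]
    exact ENNReal.ofReal_le_ofReal hnorm
  refine hfin.trans ?_
  refine le_iSup_of_le (peak c ρ m) (le_iSup_of_le (differentiableOn_peak c hρ0 hρ1 m)
    (le_iSup_of_le hν (le_iSup_of_le (fun _ => (r : ℂ)) (le_iSup_of_le ?_ (le_iSup_of_le ?_
      (le_iSup_of_le (mobiusShift k r) (le_iSup_of_le (norm_mobiusShift_le hr0 hr)
        (le_iSup_of_le (minpoly_mobiusShift hr0 hr) le_rfl))))))))
  · intro _
    simpa [abs_of_nonneg hr0] using hr
  · intro _
    simp [abs_of_nonneg hr0]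

end LowerBound

/-! ### Norms of the test functions. -/

section PeakNorm

open MeasureTheory

lemma one_sub_le_norm_one_sub_mul_exp {a : ℝ} (ha0 : 0 ≤ a) (θ : ℝ) :
    1 - a ≤ ‖1 - a * Complex.exp (θ * Complex.I)‖ := by
  have h := norm_sub_norm_le (1 : ℂ) (a * Complex.exp (θ * Complex.I))
  rwa [norm_one, norm_mul, Complex.norm_exp_ofReal_mul_I, Complex.norm_real,
    Real.norm_of_nonneg ha0, mul_one] at h

/-- Parseval for the geometric series of (1-az)⁻¹. -/
lemma integral_norm_one_sub_mul_exp {a : ℝ} (ha0 : 0 ≤ a) (ha : a < 1) :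
    ∫ θ in (0 : ℝ)..2 * Real.pi, (‖1 - a * Complex.exp (θ * Complex.I)‖ ^ 2)⁻¹ =
      2 * Real.pi * (1 - a ^ 2)⁻¹ := by
  have hsum : Summable fun j : ℕ => ‖(a : ℂ) ^ j‖ := by
    simpa [abs_of_nonneg ha0] using summable_geometric_of_lt_one ha0 ha
  have h := integral_tsum_mul_tsum_neg hsum hsum
  have hgeom : ∀ w : ℂ, ‖w‖ = 1 → ∑' j : ℕ, (a : ℂ) ^ j * w ^ j = (1 - a * w)⁻¹ := by
    intro w hw
    simp only [← mul_pow]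
    refine tsum_geometric_of_norm_lt_one ?_
    rw [norm_mul, hw, Complex.norm_real, Real.norm_of_nonneg ha0, mul_one]
    exact ha
  have h1 : ∀ θ : ℝ, (∑' j : ℕ, (a : ℂ) ^ j * Complex.exp ((j : ℤ) * (θ * Complex.I))) *
      ∑' k : ℕ, (a : ℂ) ^ k * Complex.exp ((-(k : ℤ) : ℤ) * (θ * Complex.I)) =
      (((‖1 - a * Complex.exp (θ * Complex.I)‖ ^ 2)⁻¹ : ℝ) : ℂ) := by
    intro θ
    have e1 : ∀ j : ℕ, Complex.exp ((j : ℤ) * (θ * Complex.I)) =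
        Complex.exp (θ * Complex.I) ^ j := fun j => by
      rw [← Complex.exp_nat_mul]
      simp
    have e2 : ∀ j : ℕ, Complex.exp ((-(j : ℤ) : ℤ) * (θ * Complex.I)) =
        conj (Complex.exp (θ * Complex.I)) ^ j := fun j => by
      rw [← Complex.exp_conj, ← Complex.exp_nat_mul]
      simp
    simp only [e1, e2]
    rw [hgeom _ (Complex.norm_exp_ofReal_mul_I θ), hgeom _ (by
      rw [RCLike.norm_conj]
      exact Complex.norm_exp_ofReal_mul_I θ)]
    have h2 : 1 - (a : ℂ) * conj (Complex.exp (θ * Complex.I)) =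
        conj (1 - (a : ℂ) * Complex.exp (θ * Complex.I)) := by
      rw [map_sub, map_one, map_mul, Complex.conj_ofReal]
    rw [h2, ← mul_inv, Complex.mul_conj, Complex.normSq_eq_norm_sq]
    push_cast
    rfl
  have h3 : ∑' k : ℕ, (a : ℂ) ^ k * (a : ℂ) ^ k = (((1 - a ^ 2)⁻¹ : ℝ) : ℂ) := by
    simp only [← mul_pow]
    rw [tsum_geometric_of_norm_lt_one]
    · push_cast
      ring
    · rw [norm_mul, Complex.norm_real, Real.norm_of_nonneg ha0]
      nlinarith
  simp only [h1] at h
  rw [h3, intervalIntegral.integral_ofReal] at h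
  exact_mod_cast h

/-- Since |1-ae^{iθ}| ≥ 1-a, the excess exponent q-2 can be pulled out, leaving the exactly
computable case q = 2. -/
lemma lintegral_norm_one_sub_mul_exp_rpow_le {a q : ℝ} (ha0 : 0 ≤ a) (ha : a < 1) (hq : 2 ≤ q) :
    ∫⁻ θ in Set.Ioc 0 (2 * Real.pi),
        ENNReal.ofReal (‖1 - a * Complex.exp (θ * Complex.I)‖ ^ (-q)) ≤
      ENNReal.ofReal (2 * Real.pi * (1 - a) ^ (1 - q)) := by
  have h1a : 0 < 1 - a := by linarith
  have hpos : ∀ θ : ℝ, 0 < ‖1 - a * Complex.exp (θ * Complex.I)‖ := fun θ =>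
    h1a.trans_le (one_sub_le_norm_one_sub_mul_exp ha0 θ)
  have hpt : ∀ θ : ℝ, ‖1 - a * Complex.exp (θ * Complex.I)‖ ^ (-q) ≤
      (1 - a) ^ (2 - q) * (‖1 - a * Complex.exp (θ * Complex.I)‖ ^ 2)⁻¹ := by
    intro θ
    have h1 : -q = (2 - q) + (-2 : ℝ) := by ring
    rw [h1, Real.rpow_add (hpos θ), Real.rpow_neg (hpos θ).le 2, Real.rpow_two]
    refine mul_le_mul_of_nonneg_right ?_ (by positivity)
    exact Real.rpow_le_rpow_of_nonpos h1a (one_sub_le_norm_one_sub_mul_exp ha0 θ) (by linarith)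
  have hcont : Continuous fun θ : ℝ => (‖1 - a * Complex.exp (θ * Complex.I)‖ ^ 2)⁻¹ := by
    refine Continuous.inv₀ (by fun_prop) fun θ => (pow_pos (hpos θ) 2).ne'
  calc _ ≤ ∫⁻ θ in Set.Ioc 0 (2 * Real.pi), ENNReal.ofReal
        ((1 - a) ^ (2 - q) * (‖1 - a * Complex.exp (θ * Complex.I)‖ ^ 2)⁻¹) :=
        lintegral_mono fun θ => ENNReal.ofReal_le_ofReal (hpt θ)
    _ = ENNReal.ofReal ((1 - a) ^ (2 - q) * (2 * Real.pi * (1 - a ^ 2)⁻¹)) := by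
        rw [← integral_norm_one_sub_mul_exp ha0 ha, ← intervalIntegral.integral_const_mul,
          intervalIntegral.integral_of_le Real.two_pi_pos.le, ofReal_integral_eq_lintegral_ofReal]
        · exact ((hcont.const_mul _).intervalIntegrable 0 (2 * Real.pi)).1
        · exact .of_forall fun θ => by positivity
    _ ≤ _ := by
        refine ENNReal.ofReal_le_ofReal ?_
        have h2 : (1 - a) ^ (2 - q) = (1 - a) ^ (1 - q) * (1 - a) := by
          rw [← Real.rpow_add_one h1a.ne']
          congr 1
          ring
        have h3 : (1 - a ^ 2)⁻¹ ≤ (1 - a)⁻¹ := by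
          refine inv_anti₀ h1a ?_
          nlinarith
        calc _ ≤ (1 - a) ^ (2 - q) * (2 * Real.pi * (1 - a)⁻¹) := by gcongr
          _ = _ := by
            rw [h2]
            field_simp

lemma lintegral_peak_circleMap_le {c ρ p s : ℝ} {m : ℕ} (hc : 0 ≤ c) (hρ0 : 0 ≤ ρ) (hρ : ρ < 1)
    (hp : 1 ≤ p) (hm : 1 ≤ m) (hs0 : 0 ≤ s) (hs : s ≤ 1) :
    ∫⁻ θ in Set.Ioc 0 (2 * Real.pi), ‖peak c ρ m (circleMap 0 s θ)‖ₑ ^ p ≤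
      ENNReal.ofReal (2 * Real.pi * (c ^ p * (1 - ρ * s) ^ (1 - (m + 1) * p))) := by
  have hp0 : 0 < p := by linarith
  have hm' : (1 : ℝ) ≤ m := by exact_mod_cast hm
  have h1 : ∀ θ : ℝ, ‖peak c ρ m (circleMap 0 s θ)‖ₑ ^ p = ENNReal.ofReal (c ^ p) *
      ENNReal.ofReal (‖1 - (ρ * s : ℝ) * Complex.exp (θ * Complex.I)‖ ^ (-((m + 1) * p))) := by
    intro θ
    have h2 : (ρ : ℂ) * circleMap 0 s θ = (ρ * s : ℝ) * Complex.exp (θ * Complex.I) := by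
      rw [circleMap_zero]
      push_cast
      ring
    rw [← ofReal_norm, ENNReal.ofReal_rpow_of_nonneg (norm_nonneg _) hp0.le, peak, h2, norm_mul,
      Complex.norm_real, Real.norm_of_nonneg hc, norm_div, norm_one, norm_pow,
      Real.mul_rpow hc (by positivity), ENNReal.ofReal_mul (by positivity), one_div,
      Real.inv_rpow (by positivity), Real.rpow_neg (norm_nonneg _),
      Real.rpow_mul (norm_nonneg _)]
    norm_cast
  simp only [h1]
  rw [lintegral_const_mul' _ _ ENNReal.ofReal_ne_top]
  calc _ ≤ ENNReal.ofReal (c ^ p) *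
        ENNReal.ofReal (2 * Real.pi * (1 - ρ * s) ^ (1 - (m + 1) * p)) := by
        gcongr
        exact lintegral_norm_one_sub_mul_exp_rpow_le (by positivity) (by nlinarith) (by nlinarith)
    _ = _ := by
        rw [← ENNReal.ofReal_mul (by positivity)]
        congr 1
        ring

/-- Here m = 1 suffices: the exponent 2p is at least 2 for every p ≥ 1. The scalar is spelled to
match D = 1, m = 1 in `le_supPtakYoung_of_peak`. -/
lemma hardyNorm_peak_le_one {ρ p : ℝ} (hρ0 : 0 ≤ ρ) (hρ : ρ < 1) (hp : 1 ≤ p) :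
    hardyNorm p (peak (1 * (1 - ρ) ^ (((1 : ℕ) : ℝ) + 1 - 1 / p)) ρ 1) ≤ 1 := by
  have hp0 : 0 < p := by linarith
  have h1ρ : 0 < 1 - ρ := by linarith
  refine iSup₂_le fun s hs => ?_
  refine ENNReal.rpow_le_one ?_ (by positivity)
  rw [mul_comm, ← div_eq_mul_inv]
  refine ENNReal.div_le_of_le_mul ?_
  rw [one_mul (ENNReal.ofReal _)]
  refine (lintegral_peak_circleMap_le (by positivity) hρ0 hρ hp le_rfl hs.1 hs.2.le).trans ?_
  refine ENNReal.ofReal_le_ofReal (mul_le_of_le_one_right (by positivity) ?_)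
  rw [one_mul, ← Real.rpow_mul h1ρ.le]
  calc _ ≤ (1 - ρ) ^ ((((1 : ℕ) : ℝ) + 1 - 1 / p) * p) *
        (1 - ρ) ^ (1 - (((1 : ℕ) : ℝ) + 1) * p) := by
        gcongr 1
        refine Real.rpow_le_rpow_of_nonpos h1ρ ?_ ?_
        · nlinarith [hs.1, hs.2]
        · push_cast
          linarith
    _ = 1 := by
        rw [← Real.rpow_add h1ρ]
        have : (((1 : ℕ) : ℝ) + 1 - 1 / p) * p + (1 - (((1 : ℕ) : ℝ) + 1) * p) = 0 := by
          field_simp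
          ring
        rw [this, Real.rpow_zero]

/-- With u = 1-s and ε = 1-ρ, bound 1-ρs below by max(ε, u) and split at u = ε. The near part
converges because β > -1; the far part has constant 1/(q-β-2) ≤ 1 because q ≥ β+3. -/
lemma lintegral_rpow_mul_rpow_le {β q ρ : ℝ} (hβ : -1 < β) (hq : β + 3 ≤ q) (hρ0 : 0 ≤ ρ)
    (hρ : ρ < 1) :
    ∫⁻ s in Set.Ioo (0 : ℝ) 1, ENNReal.ofReal (s * (1 - s ^ 2) ^ β * (1 - ρ * s) ^ (1 - q)) ≤
      ENNReal.ofReal (2 ^ |β| * (1 / (β + 1) + 1) * (1 - ρ) ^ (2 + β - q)) := by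
  set ε : ℝ := 1 - ρ with hε
  have hε0 : 0 < ε := by linarith
  have hε1 : ε ≤ 1 := by linarith
  have hβ1 : 0 < β + 1 := by linarith
  set φ : ℝ → ℝ≥0∞ := fun u => ENNReal.ofReal (2 ^ |β| * (u ^ β * max ε u ^ (1 - q))) with hφ
  have hpt : ∀ s ∈ Set.Ioo (1 - (1 : ℝ)) 1,
      ENNReal.ofReal (s * (1 - s ^ 2) ^ β * (1 - ρ * s) ^ (1 - q)) ≤ φ (1 - s) := by
    intro s hs
    rw [sub_self] at hs
    have h1 := (one_sub_sq_rpow_bounds hs β).2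
    have h2 : 0 < 1 - s := by linarith [hs.2]
    have h3 : max ε (1 - s) ≤ 1 - ρ * s := by
      refine max_le ?_ ?_ <;> nlinarith [hs.1, hs.2]
    have h4 : (1 - ρ * s) ^ (1 - q) ≤ max ε (1 - s) ^ (1 - q) :=
      Real.rpow_le_rpow_of_nonpos (hε0.trans_le (le_max_left _ _)) h3 (by linarith)
    have h5 : 0 ≤ (1 - s ^ 2) ^ β := Real.rpow_nonneg (by nlinarith [hs.1, hs.2]) _
    have h6 : 0 ≤ (1 - ρ * s) ^ (1 - q) := Real.rpow_nonneg (by nlinarith [hs.1, hs.2]) _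
    refine ENNReal.ofReal_le_ofReal ?_
    calc s * (1 - s ^ 2) ^ β * (1 - ρ * s) ^ (1 - q)
        ≤ 1 * (2 ^ |β| * (1 - s) ^ β) * max ε (1 - s) ^ (1 - q) := by
          have := hs.2.le
          gcongr
      _ = _ := by ring
  have h01 : ∫⁻ s in Set.Ioo (0 : ℝ) 1,
      ENNReal.ofReal (s * (1 - s ^ 2) ^ β * (1 - ρ * s) ^ (1 - q)) ≤
      ∫⁻ u in Set.Ioo 0 1, φ u := by
    rw [← setLIntegral_one_sub φ 1]
    refine le_trans (le_of_eq ?_) (setLIntegral_mono' measurableSet_Ioo hpt)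
    rw [sub_self]
  have hnear : ∫⁻ u in Set.Ioo 0 ε, φ u ≤
      ENNReal.ofReal (2 ^ |β| * (1 / (β + 1)) * ε ^ (2 + β - q)) := by
    have h1 : ∀ u ∈ Set.Ioo 0 ε, φ u =
        ENNReal.ofReal (2 ^ |β| * ε ^ (1 - q)) * ENNReal.ofReal (u ^ β) := by
      intro u hu
      rw [hφ, ← ENNReal.ofReal_mul (by positivity)]
      simp only [max_eq_left hu.2.le]
      congr 1
      ring
    rw [setLIntegral_congr_fun measurableSet_Ioo h1,
      lintegral_const_mul' _ _ ENNReal.ofReal_ne_top, lintegral_Ioo_rpow hβ hε0,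
      ← ENNReal.ofReal_mul (by positivity)]
    refine le_of_eq ?_
    congr 1
    have h2 : ε ^ (2 + β - q) = ε ^ (1 - q) * ε ^ (β + 1) := by
      rw [← Real.rpow_add hε0]
      congr 1
      ring
    rw [h2]
    ring
  have hfar : ∫⁻ u in Set.Ici ε, φ u ≤ ENNReal.ofReal (2 ^ |β| * ε ^ (2 + β - q)) := by
    have h1 : ∀ u ∈ Set.Ioi ε, φ u =
        ENNReal.ofReal (2 ^ |β|) * ENNReal.ofReal (u ^ (β + 1 - q)) := by
      intro u hu
      have hu0 : 0 < u := hε0.trans hu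
      rw [hφ, ← ENNReal.ofReal_mul (by positivity)]
      simp only [max_eq_right (Set.mem_Ioi.1 hu).le]
      rw [← Real.rpow_add hu0]
      congr 3
      ring
    have hlt : β + 1 - q < -1 := by linarith
    rw [setLIntegral_congr Ioi_ae_eq_Ici.symm, setLIntegral_congr_fun measurableSet_Ioi h1,
      lintegral_const_mul' _ _ ENNReal.ofReal_ne_top, ← ofReal_integral_eq_lintegral_ofReal
      (integrableOn_Ioi_rpow_of_lt hlt hε0) ?_, integral_Ioi_rpow_of_lt hlt hε0,
      ← ENNReal.ofReal_mul (by positivity)]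
    · refine ENNReal.ofReal_le_ofReal ?_
      gcongr
      rw [(by ring : β + 1 - q + 1 = 2 + β - q), neg_div, ← div_neg]
      exact div_le_self (by positivity) (by linarith)
    · exact (ae_restrict_iff' measurableSet_Ioi).2
        (.of_forall fun u hu => Real.rpow_nonneg (hε0.trans hu).le _)
  calc _ ≤ ∫⁻ u in Set.Ioo 0 1, φ u := h01
    _ ≤ ∫⁻ u in Set.Ioo 0 ε ∪ Set.Ici ε, φ u := by
        refine lintegral_mono_set fun u hu => ?_
        rcases lt_or_ge u ε with h | h
        · exact Or.inl ⟨hu.1, h⟩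
        · exact Or.inr h
    _ ≤ (∫⁻ u in Set.Ioo 0 ε, φ u) + ∫⁻ u in Set.Ici ε, φ u := lintegral_union_le _ _ _
    _ ≤ ENNReal.ofReal (2 ^ |β| * (1 / (β + 1)) * ε ^ (2 + β - q)) +
        ENNReal.ofReal (2 ^ |β| * ε ^ (2 + β - q)) := add_le_add hnear hfar
    _ = _ := by
        rw [← ENNReal.ofReal_add (by positivity) (by positivity)]
        congr 1
        ring

lemma bergmanNorm_peak_le_one {ρ p β : ℝ} {m : ℕ} (hρ0 : 0 ≤ ρ) (hρ : ρ < 1) (hp : 1 ≤ p)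
    (hβ : -1 < β) (hm : β + 2 ≤ m) :
    bergmanNorm p β (peak ((2 * (2 ^ |β| * (1 / (β + 1) + 1)))⁻¹ ^ (1 / p) *
      (1 - ρ) ^ ((m : ℝ) + 1 - (2 + β) / p)) ρ m) ≤ 1 := by
  have hp0 : 0 < p := by linarith
  have hβ1 : 0 < β + 1 := by linarith
  have h1ρ : 0 < 1 - ρ := by linarith
  have hm1 : 1 ≤ m := by
    have : (1 : ℝ) ≤ m := by linarith
    exact_mod_cast this
  set C : ℝ := 2 ^ |β| * (1 / (β + 1) + 1) with hC
  have hC0 : 0 < C := by positivity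
  set c : ℝ := (2 * C)⁻¹ ^ (1 / p) * (1 - ρ) ^ ((m : ℝ) + 1 - (2 + β) / p) with hc
  have hc0 : 0 ≤ c := by positivity
  have hcp : c ^ p = (2 * C)⁻¹ * (1 - ρ) ^ ((m + 1) * p - (2 + β)) := by
    rw [hc, Real.mul_rpow (by positivity) (by positivity), ← Real.rpow_mul (by positivity),
      ← Real.rpow_mul h1ρ.le, one_div_mul_cancel hp0.ne', Real.rpow_one]
    congr 2
    field_simp
  refine ENNReal.rpow_le_one ?_ (by positivity)
  rw [mul_comm, ← div_eq_mul_inv]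
  refine ENNReal.div_le_of_le_mul ?_
  rw [one_mul, lintegral_bergman_eq (differentiableOn_peak c hρ0 hρ m).continuousOn]
  calc _ ≤ ∫⁻ s in Set.Ioo (0 : ℝ) 1, ENNReal.ofReal (2 * Real.pi * c ^ p) *
        ENNReal.ofReal (s * (1 - s ^ 2) ^ β * (1 - ρ * s) ^ (1 - (m + 1) * p)) := by
        refine setLIntegral_mono' measurableSet_Ioo fun s hs => ?_
        have h5 : 0 ≤ (1 - s ^ 2) ^ β := Real.rpow_nonneg (by nlinarith [hs.1, hs.2]) _
        have h6 : 0 ≤ s * (1 - s ^ 2) ^ β := mul_nonneg hs.1.le h5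
        calc _ ≤ ENNReal.ofReal (s * (1 - s ^ 2) ^ β) * ENNReal.ofReal
              (2 * Real.pi * (c ^ p * (1 - ρ * s) ^ (1 - (m + 1) * p))) := by
              gcongr
              exact lintegral_peak_circleMap_le hc0 hρ0 hρ hp hm1 hs.1.le hs.2.le
          _ = _ := by
              rw [← ENNReal.ofReal_mul h6, ← ENNReal.ofReal_mul (by positivity)]
              congr 1
              ring
    _ ≤ ENNReal.ofReal (2 * Real.pi * c ^ p) *
        ENNReal.ofReal (C * (1 - ρ) ^ (2 + β - (m + 1) * p)) := by
        rw [lintegral_const_mul' _ _ ENNReal.ofReal_ne_top]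
        gcongr
        exact lintegral_rpow_mul_rpow_le hβ (by nlinarith) hρ0 hρ
    _ = ENNReal.ofReal Real.pi := by
        rw [← ENNReal.ofReal_mul (by positivity), hcp]
        congr 1
        have h7 : (1 - ρ) ^ ((m + 1) * p - (2 + β)) * (1 - ρ) ^ (2 + β - (m + 1) * p) = 1 := by
          rw [← Real.rpow_add h1ρ]
          simp
        calc _ = Real.pi * (2 * C * (2 * C)⁻¹) * ((1 - ρ) ^ ((m + 1) * p - (2 + β)) *
              (1 - ρ) ^ (2 + β - (m + 1) * p)) := by ring
          _ = Real.pi := by rw [h7, mul_inv_cancel₀ (by positivity), mul_one, mul_one]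

end PeakNorm

/-- With 1-ρ = 1/(4N), the normalization (1-ρ)^{m+1-e} turns the growth N^{m+1} into N^e. The Hardy
and Bergman cases differ only in e, D and m. -/
theorem le_supPtakYoung_of_peak {n : ℕ} (hn : 1 ≤ n) {r : ℝ} (hr0 : 0 ≤ r) (hr : r < 1) {D e : ℝ}
    (hD : 0 ≤ D) (m : ℕ) {ν : (ℂ → ℂ) → ℝ≥0∞}
    (hν : ∀ ρ : ℝ, 0 ≤ ρ → ρ < 1 → ν (peak (D * (1 - ρ) ^ ((m : ℝ) + 1 - e)) ρ m) ≤ 1) :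
    ENNReal.ofReal (D * 4 ^ (e - (m + 1)) / (2 ^ (m + 2) * (m + 2).factorial) *
      ((n : ℝ) / (1 - r)) ^ e) ≤ supPtakYoung ν n r := by
  have hN1 := one_le_div_one_sub hn hr0 hr
  have hn' : (1 : ℝ) ≤ n := by exact_mod_cast hn
  have hr1 : 0 < 1 - r := by linarith
  set N : ℝ := n / (1 - r) with hN
  set ρ : ℝ := 1 - (1 - r) / (4 * n) with hρ
  have h1ρ : 1 - ρ = (4 * N)⁻¹ := by
    rw [hρ, hN]
    field_simp
    ring
  have hinv : (4 * N)⁻¹ ≤ 1 := inv_le_one_of_one_le₀ (by linarith)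
  have hinv0 : 0 < (4 * N)⁻¹ := by positivity
  have h := le_supPtakYoung hn hr0 hr (c := D * (1 - ρ) ^ ((m : ℝ) + 1 - e))
    (mul_nonneg hD (Real.rpow_nonneg (by linarith) _)) hρ m (hν ρ (by linarith) (by linarith))
  refine le_trans (le_of_eq ?_) h
  congr 1
  rw [h1ρ, ← hN, Real.inv_rpow (by positivity), ← Real.rpow_neg (by positivity), neg_sub,
    Real.mul_rpow (by norm_num) (by positivity)]
  have h2 : N ^ e = N ^ (e - (m + 1)) * N ^ (m + 1) := by
    rw [← Real.rpow_natCast, ← Real.rpow_add (by positivity)]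
    push_cast
    congr 1
    ring
  rw [h2]
  ring

end PtakYoung

theorem corollary2p2 :
    (∀ p : ℝ, 1 ≤ p → ∃ a b : ℝ, 0 < a ∧ 0 < b ∧
      ∀ (n : ℕ) (r : ℝ), 1 ≤ n → 0 ≤ r → r < 1 →
        ENNReal.ofReal (a * ((n : ℝ) / (1 - r)) ^ (1 / p)) ≤
            PtakYoung.supPtakYoung (PtakYoung.hardyNorm p) n r ∧
          PtakYoung.supPtakYoung (PtakYoung.hardyNorm p) n r ≤
            ENNReal.ofReal (b * ((n : ℝ) / (1 - r)) ^ (1 / p))) ∧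
    (∀ p β : ℝ, 1 ≤ p → -1 < β → ∃ a b : ℝ, 0 < a ∧ 0 < b ∧
      ∀ (n : ℕ) (r : ℝ), 1 ≤ n → 0 ≤ r → r < 1 →
        ENNReal.ofReal (a * ((n : ℝ) / (1 - r)) ^ ((2 + β) / p)) ≤
            PtakYoung.supPtakYoung (PtakYoung.bergmanNorm p β) n r ∧
          PtakYoung.supPtakYoung (PtakYoung.bergmanNorm p β) n r ≤
            ENNReal.ofReal (b * ((n : ℝ) / (1 - r)) ^ ((2 + β) / p))) := by
  refine ⟨fun p hp => ⟨_, _, ?_, ?_, fun n r hn hr0 hr =>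
    ⟨PtakYoung.le_supPtakYoung_of_peak hn hr0 hr zero_le_one 1 fun ρ hρ0 hρ =>
      PtakYoung.hardyNorm_peak_le_one hρ0 hρ hp,
      PtakYoung.supPtakYoung_hardyNorm_le hp hn hr0 hr⟩⟩, fun p β hp hβ => ?_⟩
  · positivity
  · positivity
  · have hβ1 : 0 < β + 1 := by linarith
    -- This choice gives (m+1)p ≥ β+3, the decay that the radial integral needs.
    obtain ⟨m, hm⟩ := exists_nat_ge (β + 2)
    refine ⟨_, _, ?_, ?_, fun n r hn hr0 hr =>
      ⟨PtakYoung.le_supPtakYoung_of_peak hn hr0 hr (by positivity) m fun ρ hρ0 hρ =>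
        PtakYoung.bergmanNorm_peak_le_one hρ0 hρ hp hβ hm,
        PtakYoung.supPtakYoung_bergmanNorm_le hp hβ hn hr0 hr⟩⟩
    · positivity
    · positivity
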